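/- Let $k$ be an algebraically closed field of characteristic $0$, let $X=\operatorname{Spec}A$ be an affine $k$-scheme ($A$ any commutative $k$-algebra), let $\mathfrak g$ be a finite-dimensional Lie algebra over $k$, and let $\Gamma$ be a finite group acting on $X$ by $k$-scheme automorphisms and on $\mathfrak g$ by Lie algebra automorphisms. Let $\mathfrak M=M(X,\mathfrak g)^\Gamma=(\mathfrak g\otimes_k A)^\Gamma$ be the Lie algebra of $\Gamma$-equivariant regular maps $X\to\mathfrak g$. Let $X_{\mathrm{rat}}$ be the set of $k$-rational points of $X$. For $x\in X_{\mathrm{rat}}$ let $\Gamma_x$ be its stabilizer in $\Gamma$, let $\mathfrak g^x=\mathfrak g^{\Gamma_x}$, so that $\alpha(x)\in\mathfrak g^x$ for $\alpha\in\mathfrak M$, and let $\mathcal R_x$ be the set of isomorphism classes of irreducible finite-dimensional representations of $\mathfrak g^x$. For $\gamma\in\Gamma$ and $[\rho]\in\mathcal R_x$ put $\gamma\cdot[\rho]=[\rho\circ\gamma^{-1}]\in\mathcal R_{\gamma\cdot x}$. Let $\mathcal E$ be the set of functions $\Psi$ on $X_{\mathrm{rat}}$ with $\Psi(x)\in\mathcal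 R_x$ and $\Psi(\gamma\cdot x)=\gamma\cdot\Psi(x)$ for all $x$ and $\gamma$, whose support, the set of $x$ for which $\Psi(x)$ is not the class of the one-dimensional trivial representation, is finite. For $\Psi\in\mathcal E$ choose a set $\mathbf x$ that contains exactly one point of each $\Gamma$-orbit in the support of $\Psi$, and representations $\rho_x:\mathfrak g^x\to\operatorname{End}_kV_x$ in the class $\Psi(x)$ for $x\in\mathbf x$. Let $\operatorname{ev}_\Psi$ be the isomorphism class of the representation of $\mathfrak M$ on $\bigotimes_{x\in\mathbf x}V_x$ in which $\alpha$ acts by $\sum_{x\in\mathbf x}1\otimes\cdots\otimes\rho_x(\alpha(x))\otimes\cdots\otimes1$ (the one-dimensional trivial representation if $\mathbf x=\emptyset$); this class does not depend on the choices. If $\mathfrak M$ is perfect, i.e. $[\mathfrak M,\mathfrak M]=\mathfrak M$, then $\Psi\mapsto\operatorname{ev}_\Psi$ is a bijection from $\mathcal E$ onto the set of isomorphism classes of irreducible finite-dimensional representations of $\mathfrak M$. In particular, $\mathfrak M$ is perfect and this map is a bijection if any one of the following conditions holds, where $\mathfrak g^\Gamma$ is the subalgebra of $\Gamma$-fixed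 points and $\mathfrak g_\Gamma=\operatorname{span}\{\gamma\cdot a-a:\gamma\in\Gamma,\ a\in\mathfrak g\}$: 1. $[\mathfrak g^\Gamma,\mathfrak g]=\mathfrak g$; 2. $\mathfrak g$ is simple, and $\mathfrak g^\Gamma\neq\{0\}$ is perfect and acts on $\mathfrak g_\Gamma$ without a nonzero trivial submodule; 3. $\mathfrak g$ is semisimple and $\Gamma$ acts on $\mathfrak g$ by diagram automorphisms, that is, there are Chevalley generators $e_i,f_i,h_i$ $(i\in I)$ of $\mathfrak g$ and an action of $\Gamma$ on the Dynkin diagram with vertex set $I$ such that $\gamma\cdot e_i=e_{\gamma\cdot i}$, $\gamma\cdot f_i=f_{\gamma\cdot i}$ and $\gamma\cdot h_i=h_{\gamma\cdot i}$ for all $\gamma\in\Gamma$ and $i\in I$. -/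

import Mathlib

open scoped TensorProduct

universe u v w w₁ w₂

/-! ### Finite-dimensional representations and their isomorphism classes -/

section Representations

/- `Module.End k V` is a Lie ring under the commutator. -/
attribute [local instance 100] LieRing.ofAssociativeRing

/-- A finite-dimensional representation `ρ : L → End_k V` of a Lie algebra `L` over `k`. -/
structure LieFDRep (k : Type u) [Field k] (L : Type v) [LieRing L] [LieAlgebra k L] :
    Type (max u v (w + 1)) where
  V : Type w
  [addCommGroup : AddCommGroup V]
  [module : Module k V]
  [finite : FiniteDimensional k V]
  ρ : L →ₗ⁅k⁆ Module.End k V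

namespace LieFDRep

attribute [instance] LieFDRep.addCommGroup LieFDRep.module LieFDRep.finite

section

variable {k : Type u} [Field k] {L : Type v} [LieRing L] [LieAlgebra k L]
  {L' : Type w₁} [LieRing L'] [LieAlgebra k L']

/-- The underlying space of a representation as a Lie module: `⁅a, v⁆ = ρ a v`. -/
instance (M : LieFDRep.{u, v, w} k L) : LieRingModule L M.V := LieRingModule.compLieHom M.V M.ρ

instance (M : LieFDRep.{u, v, w} k L) : LieModule k L M.V := LieModule.compLieHom M.V M.ρ

theorem lie_def (M : LieFDRep.{u, v, w} k L) (a : L) (m : M.V) : ⁅a, m⁆ = M.ρ a m := rfl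

/-- Isomorphism of representations, as an equivalence relation. -/
instance isoSetoid (k : Type u) [Field k] (L : Type v) [LieRing L] [LieAlgebra k L] :
    Setoid (LieFDRep.{u, v, w} k L) where
  r M N := Nonempty (M.V ≃ₗ⁅k,L⁆ N.V)
  iseqv :=
    { refl := fun _ => ⟨LieModuleEquiv.refl⟩
      symm := fun ⟨e⟩ => ⟨e.symm⟩
      trans := fun ⟨e⟩ ⟨f⟩ => ⟨e.trans f⟩ }

/-- Irreducible: nonzero, with no invariant subspaces other than `0` and `V`. -/
def IsIrreducible (M : LieFDRep.{u, v, w} k L) : Prop := LieModule.IsIrreducible k L M.V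

/-- The representation `ρ ∘ φ` of `L'`, for a Lie algebra homomorphism `φ : L' → L`. -/
def pullback (M : LieFDRep.{u, v, w} k L) (φ : L' →ₗ⁅k⁆ L) : LieFDRep.{u, w₁, w} k L' where
  V := M.V
  ρ := M.ρ.comp φ

/-- The one-dimensional trivial representation. -/
def trivial (k : Type u) [Field k] (L : Type v) [LieRing L] [LieAlgebra k L] :
    LieFDRep.{u, v, max u w} k L where
  V := ULift.{w} k
  ρ := 0

section Tensor

variable {ι : Type w₁} [DecidableEq ι] (M : ι → LieFDRep.{u, v, w} k L)

/-- `1 ⊗ ⋯ ⊗ f ⊗ ⋯ ⊗ 1`, with `f` in the `i`-th place. -/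
noncomputable def tensorSingle (i : ι) (f : Module.End k (M i).V) :
    Module.End k (⨂[k] j, (M j).V) :=
  PiTensorProduct.map (Function.update (fun _ => LinearMap.id) i f)

theorem tensorSingle_mul (i : ι) (f g : Module.End k (M i).V) :
    tensorSingle M i (f * g) = tensorSingle M i f * tensorSingle M i g := by
  rw [tensorSingle, tensorSingle, tensorSingle, ← PiTensorProduct.map_mul]
  congr 1
  funext j
  by_cases h : j = i
  · subst h; simp
  · simp [h]; rfl

theorem tensorSingle_comm {i j : ι} (h : i ≠ j) (f : Module.End k (M i).V)
    (g : Module.End k (M j).V) :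
    tensorSingle M i f * tensorSingle M j g = tensorSingle M j g * tensorSingle M i f := by
  rw [tensorSingle, tensorSingle, ← PiTensorProduct.map_mul, ← PiTensorProduct.map_mul]
  congr 1
  funext l
  by_cases hi : l = i
  · subst hi; simp [h]; rfl
  · by_cases hj : l = j
    · subst hj; simp [hi]; rfl
    · simp [hi, hj]

theorem update_apply_eq (i : ι) (f : Module.End k (M i).V) (m : ∀ j, (M j).V) :
    (fun j => (Function.update (fun _ => LinearMap.id) i f : ∀ j, Module.End k (M j).V) j (m j)) =
      Function.update m i (f (m i)) := by
  funext j
  by_cases h : j = i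
  · subst h; simp
  · simp [h]

theorem tensorSingle_add (i : ι) (f g : Module.End k (M i).V) :
    tensorSingle M i (f + g) = tensorSingle M i f + tensorSingle M i g := by
  unfold tensorSingle
  ext m
  simp only [LinearMap.compMultilinearMap_apply, PiTensorProduct.map_tprod, LinearMap.add_apply,
    update_apply_eq]
  exact MultilinearMap.map_update_add _ m i (f (m i)) (g (m i))

theorem tensorSingle_smul (i : ι) (c : k) (f : Module.End k (M i).V) :
    tensorSingle M i (c • f) = c • tensorSingle M i f := by
  unfold tensorSingle
  ext m
  simp only [LinearMap.compMultilinearMap_apply, PiTensorProduct.map_tprod, LinearMap.smul_apply,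
    update_apply_eq]
  exact MultilinearMap.map_update_smul _ m i c (f (m i))

/-- The tensor product of finitely many representations of `L`:
`a ↦ ∑ i, 1 ⊗ ⋯ ⊗ ρ_i a ⊗ ⋯ ⊗ 1`. The empty tensor product is the trivial representation. -/
noncomputable def tensor [Fintype ι] : LieFDRep.{u, v, max u w w₁} k L where
  V := ⨂[k] i, (M i).V
  ρ :=
    { toFun := fun a => ∑ i, tensorSingle M i ((M i).ρ a)
      map_add' := fun a b => by
        simp only [map_add, tensorSingle_add, Finset.sum_add_distrib]
      map_smul' := fun c a => by
        simp only [map_smul, tensorSingle_smul, Finset.smul_sum, RingHom.id_apply]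
      map_lie' := fun {a b} => by
        have key : ∀ i, tensorSingle M i ((M i).ρ ⁅a, b⁆) =
            tensorSingle M i ((M i).ρ a) * tensorSingle M i ((M i).ρ b) -
              tensorSingle M i ((M i).ρ b) * tensorSingle M i ((M i).ρ a) := fun i => by
          rw [LieHom.map_lie, LieRing.of_associative_ring_bracket, eq_sub_iff_add_eq,
            ← tensorSingle_mul, ← tensorSingle_mul, ← tensorSingle_add, sub_add_cancel]
        simp only [key]
        rw [LieRing.of_associative_ring_bracket, Finset.sum_mul_sum, Finset.sum_mul_sum,
          Finset.sum_comm (s := Finset.univ) (t := Finset.univ) (f := fun i j =>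
            tensorSingle M i ((M i).ρ b) * tensorSingle M j ((M j).ρ a)),
          ← Finset.sum_sub_distrib]
        refine Finset.sum_congr rfl fun i _ => ?_
        rw [← Finset.sum_sub_distrib]
        rw [Finset.sum_eq_single i]
        · intro j _ hj
          rw [tensorSingle_comm M hj.symm, sub_self]
        · simp }

end Tensor

end

end LieFDRep

end Representations

/-- Isomorphism classes of finite-dimensional representations of `L`. -/
def RepClass (k : Type u) [Field k] (L : Type v) [LieRing L] [LieAlgebra k L] :
    Type (max u v (w + 1)) :=
  Quotient (LieFDRep.isoSetoid.{u, v, w} k L)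

namespace RepClass

variable {k : Type u} [Field k] {L : Type v} [LieRing L] [LieAlgebra k L]
  {L' : Type w₁} [LieRing L'] [LieAlgebra k L']

/-- The isomorphism class of a representation. -/
def mk (M : LieFDRep.{u, v, w} k L) : RepClass.{u, v, w} k L := Quotient.mk _ M

/-- A class is irreducible if its members are. -/
def IsIrreducible (c : RepClass.{u, v, w} k L) : Prop :=
  ∃ M : LieFDRep.{u, v, w} k L, mk M = c ∧ M.IsIrreducible

/-- The class `[ρ ∘ φ]` for a Lie algebra homomorphism `φ : L' → L`. -/
def pullback (c : RepClass.{u, v, w} k L) (φ : L' →ₗ⁅k⁆ L) : RepClass.{u, w₁, w} k L' :=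
  Quotient.map (fun M => M.pullback φ) (fun M N (h : Nonempty (M.V ≃ₗ⁅k,L⁆ N.V)) => by
    obtain ⟨e⟩ := h
    refine ⟨?_⟩
    exact { e.toLinearEquiv with
      map_lie' := fun {a m} => e.toLieModuleHom.map_lie (φ a) m }) c

/-- The class of the one-dimensional trivial representation. -/
def trivial (k : Type u) [Field k] (L : Type v) [LieRing L] [LieAlgebra k L] :
    RepClass.{u, v, max u w} k L := mk (LieFDRep.trivial.{u, v, w} k L)

end RepClass

/-- A Lie algebra `L` is perfect if `[L, L] = L`. -/
def LieAlgebra.IsPerfect (k : Type u) [CommRing k] (L : Type v) [LieRing L] [LieAlgebra k L] :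
    Prop :=
  ⁅(⊤ : LieIdeal k L), (⊤ : LieIdeal k L)⁆ = ⊤

/-! ### Group actions on Lie algebras -/

/-- The additive action of `Γ` on the Lie ring `𝔤` respects the bracket. -/
class IsLieAction (Γ : Type*) (𝔤 : Type*) [Group Γ] [LieRing 𝔤] [DistribMulAction Γ 𝔤] :
    Prop where
  smul_lie_smul : ∀ (γ : Γ) (a b : 𝔤), γ • ⁅a, b⁆ = ⁅γ • a, γ • b⁆

section Action

variable (k : Type u) [Field k] (Γ : Type w₁) [Group Γ]
  (𝔤 : Type w₂) [LieRing 𝔤] [LieAlgebra k 𝔤] [DistribMulAction Γ 𝔤] [SMulCommClass Γ k 𝔤]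
  [IsLieAction Γ 𝔤]

/-- The subalgebra of `𝔤` fixed by all elements of a subgroup `H` of `Γ`. -/
def fixedSubalgebra (H : Subgroup Γ) : LieSubalgebra k 𝔤 where
  carrier := {a | ∀ γ ∈ H, γ • a = a}
  add_mem' ha hb γ hγ := by rw [smul_add, ha γ hγ, hb γ hγ]
  zero_mem' γ _ := smul_zero γ
  smul_mem' c a ha γ hγ := by rw [smul_comm, ha γ hγ]
  lie_mem' ha hb γ hγ := by rw [IsLieAction.smul_lie_smul, ha γ hγ, hb γ hγ]

/-- `𝔤^Γ`, the fixed points of `Γ`. -/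
abbrev invariants : LieSubalgebra k 𝔤 := fixedSubalgebra k Γ 𝔤 ⊤

/-- `𝔤_Γ`, the span of all `γ • a - a`. -/
def movedSubspace : Submodule k 𝔤 :=
  Submodule.span k {b | ∃ (γ : Γ) (a : 𝔤), b = γ • a - a}

/-- `[𝔤^Γ, 𝔤] = 𝔤`. -/
def InvariantsGenerate : Prop :=
  Submodule.span k {b : 𝔤 | ∃ a ∈ invariants k Γ 𝔤, ∃ c : 𝔤, b = ⁅a, c⁆} = ⊤

/-- `𝔤` is simple, and `𝔤^Γ ≠ 0` is perfect and acts on `𝔤_Γ` without nonzero trivial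
submodule. -/
def SimplePerfectInvariants : Prop :=
  LieAlgebra.IsSimple k 𝔤 ∧ invariants k Γ 𝔤 ≠ ⊥ ∧
    LieAlgebra.IsPerfect k (invariants k Γ 𝔤) ∧
    ∀ N : LieSubmodule k (invariants k Γ 𝔤) 𝔤, N.toSubmodule ≤ movedSubspace k Γ 𝔤 →
      LieModule.IsTrivial (invariants k Γ 𝔤) N → N = ⊥

/-- `Γ` acts by diagram automorphisms: `𝔤` is semisimple, and for some Cartan subalgebra `H` and
Chevalley generators `e i`, `f i`, `h i` with Cartan matrix `A` there is an action of `Γ` on the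
Dynkin diagram (on the index set, preserving `A`) such that every `γ ∈ Γ` permutes the
Chevalley generators accordingly. -/
def ActsByDiagramAutomorphisms : Prop :=
  LieAlgebra.IsSemisimple k 𝔤 ∧
    ∃ (n : ℕ) (H : LieSubalgebra k 𝔤) (b : LieAlgebra.Basis (Fin n) H)
      (π : Γ →* Equiv.Perm (Fin n)), ∀ (γ : Γ),
        (∀ i j, b.A (π γ i) (π γ j) = b.A i j) ∧
        ∀ i, γ • b.e i = b.e (π γ i) ∧ γ • b.f i = b.f (π γ i) ∧ γ • b.h i = b.h (π γ i)

end Action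

/-! ### Equivariant map algebras

An affine scheme over `k` is `X = Spec A` for a commutative `k`-algebra `A`, and an action of `Γ`
on `X` is an action of `Γ` on `A` by `k`-algebra automorphisms, `(γ • f)(x) = f (γ⁻¹ • x)`. Regular
maps `X → 𝔤` are the elements of `A ⊗ 𝔤`. -/

/-- The `k`-rational points of `X = Spec A`. -/
def RatPoint (k : Type u) [Field k] (A : Type v) [CommRing A] [Algebra k A] : Type (max u v) :=
  A →ₐ[k] k

section EMA

variable (k : Type u) [Field k] (Γ : Type w₁) [Group Γ]
  (A : Type v) [CommRing A] [Algebra k A] [MulSemiringAction Γ A] [SMulCommClass Γ k A]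
  (𝔤 : Type w₂) [LieRing 𝔤] [LieAlgebra k 𝔤] [DistribMulAction Γ 𝔤] [SMulCommClass Γ k 𝔤]

variable {k A} in
/-- The value `f(x)` of a function `f ∈ A` at a rational point `x`. -/
def RatPoint.eval (x : RatPoint k A) : A →ₐ[k] k := x

/-- The action of `Γ` on the rational points: `f (γ • x) = (γ⁻¹ • f)(x)`. -/
instance : MulAction Γ (RatPoint k A) where
  smul γ x := x.eval.comp (MulSemiringAction.toAlgHom k A γ⁻¹)
  one_smul x := by
    refine AlgHom.ext fun f => ?_
    change x.eval ((1 : Γ)⁻¹ • f) = x.eval f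
    rw [inv_one, one_smul]
  mul_smul γ δ x := by
    refine AlgHom.ext fun f => ?_
    change x.eval ((γ * δ)⁻¹ • f) = x.eval (δ⁻¹ • (γ⁻¹ • f))
    rw [mul_inv_rev, mul_smul]

variable {Γ k A} in
theorem RatPoint.eval_smul (γ : Γ) (x : RatPoint k A) (f : A) :
    (γ • x).eval f = x.eval (γ⁻¹ • f) := rfl

/-- The diagonal action of `γ ∈ Γ` on `A ⊗ 𝔤`. -/
noncomputable def diagAct (γ : Γ) : A ⊗[k] 𝔤 →ₗ[k] A ⊗[k] 𝔤 :=
  TensorProduct.map (DistribSMul.toLinearMap k A γ) (DistribSMul.toLinearMap k 𝔤 γ)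

variable {A 𝔤} in
@[simp] theorem diagAct_tmul (γ : Γ) (f : A) (a : 𝔤) :
    diagAct k Γ A 𝔤 γ (f ⊗ₜ a) = (γ • f) ⊗ₜ (γ • a) := rfl

variable [IsLieAction Γ 𝔤]

theorem diagAct_lie (γ : Γ) (α β : A ⊗[k] 𝔤) :
    diagAct k Γ A 𝔤 γ ⁅α, β⁆ = ⁅diagAct k Γ A 𝔤 γ α, diagAct k Γ A 𝔤 γ β⁆ := by
  induction α using TensorProduct.induction_on with
  | zero => simp
  | add x y hx hy => simp only [add_lie, map_add, hx, hy]
  | tmul f a =>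
    induction β using TensorProduct.induction_on with
    | zero => simp
    | add x y hx hy => simp only [lie_add, map_add, hx, hy]
    | tmul g b => simp [IsLieAction.smul_lie_smul, smul_mul']

/-- The equivariant map algebra `𝔐 = M(X, 𝔤)^Γ = (A ⊗ 𝔤)^Γ`. -/
noncomputable def EquivariantMapAlgebra : LieSubalgebra k (A ⊗[k] 𝔤) where
  carrier := {α | ∀ γ : Γ, diagAct k Γ A 𝔤 γ α = α}
  add_mem' ha hb γ := by rw [map_add, ha γ, hb γ]
  zero_mem' γ := map_zero _
  smul_mem' c a ha γ := by rw [map_smul, ha γ]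
  lie_mem' ha hb γ := by rw [diagAct_lie, ha γ, hb γ]

variable {k A} in
/-- The subalgebra `𝔤^x` of `𝔤` fixed by the stabilizer `Γ_x` of a rational point `x`. -/
abbrev pointSubalgebra (x : RatPoint k A) : LieSubalgebra k 𝔤 :=
  fixedSubalgebra k Γ 𝔤 (MulAction.stabilizer Γ x)

end EMA

section Evaluation

variable {k : Type u} [Field k] {A : Type v} [CommRing A] [Algebra k A]
  {𝔤 : Type w₂} [LieRing 𝔤] [LieAlgebra k 𝔤]

/-- Evaluation `A ⊗ 𝔤 → 𝔤`, `f ⊗ a ↦ f(x) a`, at a rational point. -/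
noncomputable def evalLin (x : RatPoint k A) : A ⊗[k] 𝔤 →ₗ[k] 𝔤 :=
  TensorProduct.lift ((LinearMap.lsmul k 𝔤 : k →ₗ[k] 𝔤 →ₗ[k] 𝔤).comp x.eval.toLinearMap)

@[simp] theorem evalLin_tmul (x : RatPoint k A) (f : A) (a : 𝔤) :
    evalLin x (f ⊗ₜ[k] a) = x.eval f • a := rfl

theorem evalLin_lie (x : RatPoint k A) (α β : A ⊗[k] 𝔤) :
    evalLin x ⁅α, β⁆ = ⁅evalLin x α, evalLin x β⁆ := by
  induction α using TensorProduct.induction_on with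
  | zero => simp
  | add y z hy hz => simp only [add_lie, map_add, hy, hz]
  | tmul f a =>
    induction β using TensorProduct.induction_on with
    | zero => simp
    | add y z hy hz => simp only [lie_add, map_add, hy, hz]
    | tmul g b => simp [mul_smul, smul_comm (x.eval f) (x.eval g)]

variable {Γ : Type w₁} [Group Γ] [MulSemiringAction Γ A] [SMulCommClass Γ k A]
  [DistribMulAction Γ 𝔤] [SMulCommClass Γ k 𝔤]

theorem evalLin_diagAct (γ : Γ) (x : RatPoint k A) (α : A ⊗[k] 𝔤) :
    evalLin (γ • x) (diagAct k Γ A 𝔤 γ α) = γ • evalLin x α := by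
  induction α using TensorProduct.induction_on with
  | zero => simp
  | add y z hy hz => simp only [map_add, smul_add, hy, hz]
  | tmul f a => simp [RatPoint.eval_smul, smul_comm γ]

variable [IsLieAction Γ 𝔤]

/-- Evaluation `ev_x : 𝔐 → 𝔤^x`, `α ↦ α(x)`. -/
noncomputable def evalHom (Γ : Type w₁) [Group Γ] [MulSemiringAction Γ A] [SMulCommClass Γ k A]
    [DistribMulAction Γ 𝔤] [SMulCommClass Γ k 𝔤] [IsLieAction Γ 𝔤] (x : RatPoint k A) :
    EquivariantMapAlgebra k Γ A 𝔤 →ₗ⁅k⁆ pointSubalgebra Γ 𝔤 x where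
  toFun α := ⟨evalLin x α.1, fun γ hγ => by
    rw [← evalLin_diagAct, MulAction.mem_stabilizer_iff.1 hγ, α.2 γ]⟩
  map_add' α β := Subtype.ext (map_add (evalLin x) α.1 β.1)
  map_smul' c α := Subtype.ext (map_smul (evalLin x) c α.1)
  map_lie' := Subtype.ext (evalLin_lie x _ _)

/-- The map `𝔤^{γ • x} → 𝔤^x`, `a ↦ γ⁻¹ • a`. -/
def pointShift (γ : Γ) (x : RatPoint k A) :
    pointSubalgebra Γ 𝔤 (γ • x) →ₗ⁅k⁆ pointSubalgebra Γ 𝔤 x where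
  toFun a := ⟨γ⁻¹ • a.1, fun δ hδ => by
    have h : γ * δ * γ⁻¹ ∈ MulAction.stabilizer Γ (γ • x) := by
      rw [MulAction.mem_stabilizer_iff, smul_smul, inv_mul_cancel_right, mul_smul,
        MulAction.mem_stabilizer_iff.1 hδ]
    have h2 := a.2 _ h
    rw [mul_assoc, mul_smul, ← eq_inv_smul_iff, mul_smul] at h2
    exact h2⟩
  map_add' a b := Subtype.ext (smul_add γ⁻¹ a.1 b.1)
  map_smul' c a := Subtype.ext (smul_comm γ⁻¹ c a.1)
  map_lie' := Subtype.ext (IsLieAction.smul_lie_smul γ⁻¹ _ _)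

end Evaluation

/-! ### The set `𝓔` and the map `Ψ ↦ ev_Ψ` -/

section Parameters

variable (k : Type u) [Field k] (Γ : Type w₁) [Group Γ]
  (A : Type v) [CommRing A] [Algebra k A] [MulSemiringAction Γ A] [SMulCommClass Γ k A]
  (𝔤 : Type w₂) [LieRing 𝔤] [LieAlgebra k 𝔤] [DistribMulAction Γ 𝔤] [SMulCommClass Γ k 𝔤]
  [IsLieAction Γ 𝔤]

/-- The set `𝓔` of finitely supported `Γ`-equivariant functions `Ψ` that assign to every rational
point `x` an isomorphism class `Ψ x` of irreducible finite-dimensional representations of `𝔤^x`,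
where `γ • [ρ] = [ρ ∘ γ⁻¹]` and the support is the set of `x` at which `Ψ x` is not the class of
the one-dimensional trivial representation. The spaces of the representations lie in a universe
that contains `k` and the set of rational points; every finite-dimensional representation has an
isomorphic copy there. -/
structure EvalParam where
  toFun : ∀ x : RatPoint k A, RepClass.{u, w₂, max u v} k (pointSubalgebra Γ 𝔤 x)
  irreducible : ∀ x, (toFun x).IsIrreducible
  equivariant : ∀ (γ : Γ) (x : RatPoint k A),
    (toFun x).pullback (pointShift γ x) = toFun (γ • x)
  finite_support : {x | toFun x ≠ RepClass.trivial.{u, w₂, v} k (pointSubalgebra Γ 𝔤 x)}.Finite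

namespace EvalParam

variable {k Γ A 𝔤}
variable (Ψ : EvalParam k Γ A 𝔤)

/-- The support of `Ψ`. -/
def support : Set (RatPoint k A) :=
  {x | Ψ.toFun x ≠ RepClass.trivial.{u, w₂, v} k (pointSubalgebra Γ 𝔤 x)}

/-- The finite set `s` contains exactly one element of each `Γ`-orbit in the support of `Ψ`,
and nothing else. -/
def IsTransversal (s : Finset (RatPoint k A)) : Prop :=
  (∀ x ∈ s, x ∈ Ψ.support) ∧
    ∀ x ∈ Ψ.support, ∃! y, y ∈ s ∧ y ∈ MulAction.orbit Γ x

theorem exists_transversal : ∃ s, Ψ.IsTransversal s := by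
  classical
  let q : RatPoint k A → MulAction.orbitRel.Quotient Γ (RatPoint k A) := Quotient.mk _
  have hq : ∀ x y, q x = q y ↔ x ∈ MulAction.orbit Γ y := fun x y => by
    rw [← MulAction.orbitRel_apply]; exact Quotient.eq
  have hfin : Ψ.support.Finite := Ψ.finite_support
  let T := hfin.toFinset.image q
  have hT : ∀ c : T, ∃ x ∈ Ψ.support, q x = c := fun c => by
    obtain ⟨x, hx, h⟩ := Finset.mem_image.1 c.2
    exact ⟨x, hfin.mem_toFinset.1 hx, h⟩
  choose r hr hrq using hT
  refine ⟨Finset.univ.image r, fun x hx => ?_, fun x hx => ?_⟩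
  · obtain ⟨c, -, rfl⟩ := Finset.mem_image.1 hx
    exact hr c
  · have hc : q x ∈ T := Finset.mem_image_of_mem q (hfin.mem_toFinset.2 hx)
    refine ⟨r ⟨q x, hc⟩, ⟨Finset.mem_image_of_mem r (Finset.mem_univ _),
      (hq _ _).1 (hrq ⟨q x, hc⟩)⟩, ?_⟩
    rintro y ⟨hy, hyx⟩
    obtain ⟨c, -, rfl⟩ := Finset.mem_image.1 hy
    congr 1
    exact Subtype.ext ((hrq c).symm.trans ((hq _ _).2 hyx))

end EvalParam

variable {k A 𝔤}

open Classical in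
/-- The evaluation representation `ev_s (ρ_x)_{x ∈ s}` of `𝔐` on `⨂_{x ∈ s} V_x`, in which `α` acts
by `∑_{x ∈ s} 1 ⊗ ⋯ ⊗ ρ_x (α(x)) ⊗ ⋯ ⊗ 1`. -/
noncomputable def evalRep (s : Finset (RatPoint k A))
    (M : ∀ x : s, LieFDRep.{u, w₂, max u v} k (pointSubalgebra Γ 𝔤 x.1)) :
    LieFDRep.{u, max v w₂, max u v} k (EquivariantMapAlgebra k Γ A 𝔤) :=
  LieFDRep.tensor fun x : s => (M x).pullback (evalHom Γ x.1)

/-- The isomorphism class `ev_Ψ` of the evaluation representation `ev_s (Ψ x)_{x ∈ s}`, where `s`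
contains one element of each `Γ`-orbit in the support of `Ψ`. It does not depend on the choice
of `s` and of the representatives of the classes. -/
noncomputable def EvalParam.evalClass {Γ} [Group Γ] [MulSemiringAction Γ A] [SMulCommClass Γ k A]
    [DistribMulAction Γ 𝔤] [SMulCommClass Γ k 𝔤] [IsLieAction Γ 𝔤] (Ψ : EvalParam k Γ A 𝔤) :
    RepClass.{u, max v w₂, max u v} k (EquivariantMapAlgebra k Γ A 𝔤) :=
  RepClass.mk (evalRep Γ Ψ.exists_transversal.choose fun x => (Ψ.toFun x.1).out)

end Parameters

/-! ### `ev_Ψ` is independent of the choices -/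

section WellDefined

open LieFDRep in
theorem LieFDRep.tensor_iso {k : Type u} [Field k] {L : Type v} [LieRing L] [LieAlgebra k L]
    {ι ι' : Type w₁} [Fintype ι] [DecidableEq ι] [Fintype ι'] [DecidableEq ι']
    (M : ι → LieFDRep.{u, v, w} k L) (N : ι' → LieFDRep.{u, v, w} k L) (e : ι ≃ ι')
    (h : ∀ i, RepClass.mk (M (e.symm i)) = RepClass.mk (N i)) :
    RepClass.mk (tensor M) = RepClass.mk (tensor N) := by
  have h' : ∀ i, Nonempty ((M (e.symm i)).V ≃ₗ⁅k,L⁆ (N i).V) := fun i => Quotient.exact (h i)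
  let g := fun i => (h' i).some
  refine Quotient.sound ?_
  let E : (⨂[k] i, (M i).V) ≃ₗ[k] ⨂[k] i, (N i).V :=
    (PiTensorProduct.reindex k (fun i => (M i).V) e).trans
      (PiTensorProduct.congr fun i => (g i).toLinearEquiv)
  refine ⟨{ E with map_lie' := ?_ }⟩
  intro a m
  change E ((∑ i, tensorSingle M i ((M i).ρ a)) m) = (∑ i, tensorSingle N i ((N i).ρ a)) (E m)
  have key : ∀ m : ∀ i, (M i).V, E (PiTensorProduct.tprod k m) =
      PiTensorProduct.tprod k fun i => g i (m (e.symm i)) := fun m => by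
    simp [E]
  induction m using PiTensorProduct.induction_on with
  | add x y hx hy => simp only [map_add, hx, hy]
  | smul_tprod c m =>
    simp only [map_smul]
    congr 1
    rw [key]
    simp only [LinearMap.sum_apply, map_sum, tensorSingle, PiTensorProduct.map_tprod,
      update_apply_eq, key]
    rw [← e.symm.sum_comp]
    refine Finset.sum_congr rfl fun i _ => ?_
    congr 1
    funext j
    by_cases hj : j = i
    · subst hj
      simp only [Function.update_self]
      exact (g j).toLieModuleHom.map_lie a _
    · have : e.symm j ≠ e.symm i := fun h => hj (e.symm.injective h)
      simp only [Function.update_of_ne hj, Function.update_of_ne this]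

variable {k : Type u} [Field k] {Γ : Type w₁} [Group Γ]
  {A : Type v} [CommRing A] [Algebra k A] [MulSemiringAction Γ A] [SMulCommClass Γ k A]
  {𝔤 : Type w₂} [LieRing 𝔤] [LieAlgebra k 𝔤] [DistribMulAction Γ 𝔤] [SMulCommClass Γ k 𝔤]
  [IsLieAction Γ 𝔤] (Ψ : EvalParam k Γ A 𝔤)

theorem pointShift_evalHom (γ : Γ) (x : RatPoint k A) :
    (pointShift (𝔤 := 𝔤) γ x).comp (evalHom Γ (γ • x)) = evalHom Γ x := by
  ext α
  change γ⁻¹ • evalLin (γ • x) α.1 = evalLin x α.1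
  conv_lhs => rw [← α.2 γ]
  rw [evalLin_diagAct, inv_smul_smul]

theorem EvalParam.pullback_evalHom_smul (γ : Γ) (x : RatPoint k A) :
    (Ψ.toFun (γ • x)).pullback (evalHom Γ (γ • x)) = (Ψ.toFun x).pullback (evalHom Γ x) := by
  rw [← Ψ.equivariant, ← pointShift_evalHom γ x]
  induction Ψ.toFun x using Quotient.inductionOn with
  | h M => rfl

theorem EvalParam.mk_evalRep_eq {s t : Finset (RatPoint k A)}
    (hs : Ψ.IsTransversal s) (ht : Ψ.IsTransversal t)
    (M : ∀ x : s, LieFDRep.{u, w₂, max u v} k (pointSubalgebra Γ 𝔤 x.1))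
    (N : ∀ x : t, LieFDRep.{u, w₂, max u v} k (pointSubalgebra Γ 𝔤 x.1))
    (hM : ∀ x, RepClass.mk (M x) = Ψ.toFun x.1) (hN : ∀ x, RepClass.mk (N x) = Ψ.toFun x.1) :
    RepClass.mk (evalRep Γ s M) = RepClass.mk (evalRep Γ t N) := by
  classical
  choose f hf hfu using fun x : s => ht.2 x.1 (hs.1 x.1 x.2)
  choose g hg hgu using fun x : t => hs.2 x.1 (ht.1 x.1 x.2)
  let e : s ≃ t :=
    { toFun := fun x => ⟨f x, (hf x).1⟩
      invFun := fun x => ⟨g x, (hg x).1⟩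
      left_inv := fun x => Subtype.ext (hgu ⟨f x, (hf x).1⟩ x.1
        ⟨x.2, MulAction.mem_orbit_symm.1 (hf x).2⟩).symm
      right_inv := fun x => Subtype.ext (hfu ⟨g x, (hg x).1⟩ x.1
        ⟨x.2, MulAction.mem_orbit_symm.1 (hg x).2⟩).symm }
  refine LieFDRep.tensor_iso _ _ e fun x => ?_
  change (RepClass.mk (M (e.symm x))).pullback _ = (RepClass.mk (N x)).pullback _
  rw [hM, hN]
  obtain ⟨γ, hγ⟩ := (hg x).2
  have : (e.symm x).1 = γ • x.1 := hγ.symm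
  rw [this]
  exact Ψ.pullback_evalHom_smul γ x.1

theorem EvalParam.evalClass_eq {s : Finset (RatPoint k A)} (hs : Ψ.IsTransversal s)
    (M : ∀ x : s, LieFDRep.{u, w₂, max u v} k (pointSubalgebra Γ 𝔤 x.1))
    (hM : ∀ x, RepClass.mk (M x) = Ψ.toFun x.1) :
    Ψ.evalClass = RepClass.mk (evalRep Γ s M) :=
  Ψ.mk_evalRep_eq Ψ.exists_transversal.choose_spec hs _ _ (fun _ => Quotient.out_eq _) hM

end WellDefined

/-! Irreducibility and injectivity. Averaging `f ⊗ a` over `Γ`, with `f` equal to 1 at `x` and 0 at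
the other relevant points, shows that evaluation at finitely many points in distinct orbits maps `𝔐`
onto the product of the algebras `𝔤^x` (`exists_evalHom_eq`). Hence `ev_Ψ` is an external tensor
product of irreducible representations. By Burnside's theorem it is irreducible
(`isIrreducible_tensor`), and its factors can be recovered from it (`mk_eq_of_mk_tensor_eq`).

Surjectivity. Let `ρ` be an irreducible representation of the perfect algebra `𝔐`, with kernel `K`.
The image of `ρ` is perfect, hence traceless; being irreducible, it has trivial radical. So `K` is
semiprime: an ideal whose brackets lie in `K` lies in `K` (`apply_eq_zero_of_lie_eq_zero`). This is
used twice. For an invariant function `b`, the ideal `bK` satisfies `[bκ, bκ'] = [κ, b²κ'] ∈ K`, so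
`K` is stable under `A^Γ`, and the annihilator `J` of `𝔐/K` in `A^Γ` has finite codimension
(`exists_annihilator`). Since `A` is integral over `A^Γ`, the primes of `A` over `J` are rational
points, in finitely many orbits. If `α` vanishes at these points, its coefficients generate a
finitely generated ideal `I` in the radical of `JA`. Maps with coefficients in a high power of `I`
lie in `K` by averaging, and semiprimeness descends from `I^(2^(m+1))` to `I^(2^m)`, down to `I`
(`apply_eq_zero_of_evalLin_eq_zero`). No Noetherian assumption on `A` is needed. Thus `ρ` factors
through a finite product of algebras `𝔤^x` and splits as an external tensor product
(`exists_mk_eq_tensor`), which is some `ev_Ψ`.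

Criteria. Conditions 2 and 3 both imply condition 1, and condition 1 gives perfectness because
averaging commutes with the bracket by a constant invariant map. -/

/-! ### Burnside's theorem. -/

section Burnside

variable {k : Type*} [Field k] [IsAlgClosed k] {V : Type*} [AddCommGroup V] [Module k V]
  [FiniteDimensional k V] [Nontrivial V]

/-- **Burnside's theorem**: a set of operators without nontrivial invariant subspaces generates the
full endomorphism algebra. -/
theorem Module.End.adjoin_eq_top_of_irreducible (S : Set (Module.End k V))
    (hS : ∀ W : Submodule k V, (∀ f ∈ S, ∀ w ∈ W, f w ∈ W) → W = ⊥ ∨ W = ⊤) :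
    Algebra.adjoin k S = ⊤ := by
  set A := Algebra.adjoin k S with hA
  have hsimple : IsSimpleModule A V := by
    refine { exists_pair_ne := ⟨⊥, ⊤, bot_ne_top⟩, eq_bot_or_eq_top := fun W => ?_ }
    refine (hS (W.restrictScalars k) fun f hf w hw => ?_).imp (fun h => ?_) fun h => ?_
    · exact W.smul_mem ⟨f, Algebra.subset_adjoin hf⟩ hw
    · simpa using h
    · simpa using h
  have : Module.Finite (Module.End A V) V := Module.Finite.of_restrictScalars_finite k _ _
  refine eq_top_iff.2 fun f _ => ?_
  -- By Schur's lemma the commutant of `A` consists of scalars, so every `k`-linear `f` commutes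
  -- with it; the density theorem then puts `f` in `A`.
  let f' : Module.End (Module.End A V) V :=
    { toFun := f
      map_add' := map_add f
      map_smul' := fun g v => by
        obtain ⟨c, rfl⟩ := (IsSimpleModule.algebraMap_end_bijective_of_isAlgClosed
          (A := A) (V := V) k).2 g
        simp }
  obtain ⟨a, ha⟩ := Module.Finite.toModuleEnd_moduleEnd_surjective (R := A) (M := V) f'
  have : a.1 = f := LinearMap.ext fun v => congr($ha v)
  exact this ▸ a.2

end Burnside

/-! ### Irreducible representations and Schur's lemma. -/

namespace LieFDRep

section Irreducible

variable {k : Type u} [Field k] {L : Type v} [LieRing L] [LieAlgebra k L]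
  {L' : Type w₁} [LieRing L'] [LieAlgebra k L']

theorem IsIrreducible.nontrivial {M : LieFDRep.{u, v, w} k L} (h : M.IsIrreducible) :
    Nontrivial M.V :=
  have : LieModule.IsIrreducible k L M.V := h
  LieModule.nontrivial_of_isIrreducible k L M.V

theorem isIrreducible_iff (M : LieFDRep.{u, v, w} k L) :
    M.IsIrreducible ↔ Nontrivial M.V ∧
      ∀ W : Submodule k M.V, (∀ a, ∀ w ∈ W, M.ρ a w ∈ W) → W = ⊥ ∨ W = ⊤ := by
  constructor
  · intro h
    refine ⟨h.nontrivial, fun W hW => ?_⟩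
    have : LieModule.IsIrreducible k L M.V := h
    let N : LieSubmodule k L M.V := { W with lie_mem := fun {a w} hw => hW a w hw }
    refine (eq_bot_or_eq_top N).imp (fun h => ?_) fun h => ?_
    · exact congr(($h).toSubmodule)
    · exact congr(($h).toSubmodule)
  · rintro ⟨_, h⟩
    refine LieModule.IsIrreducible.mk fun N hN => ?_
    rw [← LieSubmodule.toSubmodule_eq_top]
    exact (h N.toSubmodule fun a w hw => N.lie_mem hw).resolve_left
      fun h => hN ((LieSubmodule.toSubmodule_eq_bot N).1 h)

theorem IsIrreducible.adjoin_range [IsAlgClosed k] {M : LieFDRep.{u, v, w} k L}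
    (h : M.IsIrreducible) : Algebra.adjoin k (Set.range M.ρ) = ⊤ := by
  have := h.nontrivial
  refine Module.End.adjoin_eq_top_of_irreducible _ fun W hW => ?_
  exact (M.isIrreducible_iff.1 h).2 W fun a w hw => hW _ ⟨a, rfl⟩ w hw

/-- A surjective homomorphism preserves and reflects irreducibility. -/
theorem isIrreducible_pullback (M : LieFDRep.{u, v, w} k L) (φ : L' →ₗ⁅k⁆ L)
    (hφ : Function.Surjective φ) : (M.pullback φ).IsIrreducible ↔ M.IsIrreducible := by
  rw [isIrreducible_iff, isIrreducible_iff]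
  refine and_congr Iff.rfl (forall_congr' fun W => ?_)
  refine imp_congr_left ?_
  exact ⟨fun h a => by obtain ⟨a, rfl⟩ := hφ a; exact h a, fun h a => h (φ a)⟩

/-- Schur's lemma: a nonzero homomorphism of irreducible representations is an isomorphism. -/
theorem mk_eq_of_hom_ne_zero {M : LieFDRep.{u, v, w} k L} {N : LieFDRep.{u, v, w} k L}
    (hM : M.IsIrreducible) (hN : N.IsIrreducible) (f : M.V →ₗ[k] N.V)
    (hf : ∀ a m, f (M.ρ a m) = N.ρ a (f m)) (h0 : f ≠ 0) : RepClass.mk M = RepClass.mk N := by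
  have hker : LinearMap.ker f = ⊥ := by
    refine ((M.isIrreducible_iff.1 hM).2 _ fun a w hw => ?_).resolve_right fun h => ?_
    · rw [LinearMap.mem_ker] at hw ⊢
      rw [hf, hw, map_zero]
    · exact h0 (LinearMap.ker_eq_top.1 h)
  have hrange : LinearMap.range f = ⊤ := by
    refine ((N.isIrreducible_iff.1 hN).2 _ fun a w hw => ?_).resolve_left fun h => ?_
    · obtain ⟨m, rfl⟩ := hw
      exact ⟨M.ρ a m, hf a m⟩
    · exact h0 (LinearMap.range_eq_bot.1 h)
  let e := LinearEquiv.ofBijective f ⟨LinearMap.ker_eq_bot.1 hker, LinearMap.range_eq_top.1 hrange⟩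
  exact Quotient.sound ⟨{ e with map_lie' := fun {a m} => hf a m }⟩

end Irreducible

end LieFDRep

/-! ### Irreducibility of external tensor products. -/

namespace LieFDRep

section TensorProducts

variable {k : Type u} [Field k] {L : Type v} [LieRing L] [LieAlgebra k L]
  {ι : Type w₁} [DecidableEq ι]

@[simp] theorem tensorSingle_tprod (M : ι → LieFDRep.{u, v, w} k L) (i : ι)
    (f : Module.End k (M i).V) (m : ∀ j, (M j).V) :
    tensorSingle M i f (PiTensorProduct.tprod k m) =
      PiTensorProduct.tprod k (Function.update m i (f (m i))) := by
  rw [tensorSingle, PiTensorProduct.map_tprod, update_apply_eq]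

theorem tensorSingle_one (M : ι → LieFDRep.{u, v, w} k L) (i : ι) :
    tensorSingle M i 1 = 1 := by
  unfold tensorSingle
  ext m
  simp only [LinearMap.compMultilinearMap_apply, PiTensorProduct.map_tprod, update_apply_eq]
  simp

/-- `f ↦ 1 ⊗ ⋯ ⊗ f ⊗ ⋯ ⊗ 1` as an algebra homomorphism. -/
noncomputable def tensorSingleHom (M : ι → LieFDRep.{u, v, w} k L) (i : ι) :
    Module.End k (M i).V →ₐ[k] Module.End k (⨂[k] j, (M j).V) :=
  AlgHom.ofLinearMap
    { toFun := tensorSingle M i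
      map_add' := tensorSingle_add M i
      map_smul' := tensorSingle_smul M i } (tensorSingle_one M i) (tensorSingle_mul M i)

@[simp] theorem tensorSingleHom_apply (M : ι → LieFDRep.{u, v, w} k L) (i : ι)
    (f : Module.End k (M i).V) : tensorSingleHom M i f = tensorSingle M i f := rfl

/-- A tensor product of operators is the product of its one-place factors, which are applied here
one place at a time. -/
theorem map_mem_of_tensorSingle_mem [Finite ι] (M : ι → LieFDRep.{u, v, w} k L)
    (W : Submodule k (⨂[k] j, (M j).V))
    (hW : ∀ i f, ∀ t ∈ W, tensorSingle M i f t ∈ W) (f : ∀ i, Module.End k (M i).V)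
    {t : ⨂[k] j, (M j).V} (ht : t ∈ W) : PiTensorProduct.map f t ∈ W := by
  have := Fintype.ofFinite ι
  suffices h : ∀ s : Finset ι, PiTensorProduct.map (s.piecewise f 1) t ∈ W by
    simpa using h Finset.univ
  intro s
  induction s using Finset.induction_on with
  | empty =>
    have := PiTensorProduct.map_one (R := k) (s := fun j => (M j).V)
    rw [Finset.piecewise_empty]
    erw [this]
    exact ht
  | insert i s hi ih =>
    have key : PiTensorProduct.map ((insert i s).piecewise f 1) =
        tensorSingle M i (f i) * PiTensorProduct.map (s.piecewise f 1) := by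
      rw [tensorSingle, ← PiTensorProduct.map_mul]
      congr 1
      funext j
      by_cases hj : j = i
      · subst hj; simp [hi]
      · by_cases hjs : j ∈ s
        · simp [hj, hjs]; rfl
        · simp [hj, hjs]; rfl
    rw [key]
    exact hW i _ _ ih

variable [Fintype ι]

theorem tensor_ρ_apply (M : ι → LieFDRep.{u, v, w} k L) (a : L) :
    (tensor M).ρ a = ∑ i, tensorSingle M i ((M i).ρ a) := rfl

theorem tensor_ρ_tprod (M : ι → LieFDRep.{u, v, w} k L) (a : L) (m : ∀ j, (M j).V) :
    (tensor M).ρ a (PiTensorProduct.tprod k m) =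
      (∑ i, PiTensorProduct.tprod k (Function.update m i ((M i).ρ a (m i))) :
        ⨂[k] j, (M j).V) := by
  change (∑ i, tensorSingle M i ((M i).ρ a)) (PiTensorProduct.tprod k m) = _
  rw [LinearMap.sum_apply]
  exact Finset.sum_congr rfl fun i _ => tensorSingle_tprod M i _ m

theorem tensor_ρ_eq_tensorSingle (M : ι → LieFDRep.{u, v, w} k L) (i : ι) (a : L)
    (h : ∀ j ≠ i, (M j).ρ a = 0) : (tensor M).ρ a = tensorSingle M i ((M i).ρ a) := by
  rw [tensor_ρ_apply]
  refine Finset.sum_eq_single i (fun j _ hj => ?_) fun h => (h (Finset.mem_univ i)).elim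
  rw [h j hj]
  exact map_zero (tensorSingleHom M j)

/-- The external tensor product of irreducible representations is irreducible. Externality is
expressed by the condition that `L` has enough elements acting on one factor only. -/
theorem isIrreducible_tensor [IsAlgClosed k] (M : ι → LieFDRep.{u, v, w} k L)
    (hM : ∀ i, (M i).IsIrreducible)
    (hL : ∀ i a, ∃ b, (M i).ρ b = (M i).ρ a ∧ ∀ j ≠ i, (M j).ρ b = 0) :
    (tensor M).IsIrreducible := by
  have hnt : ∀ i, Nontrivial (M i).V := fun i => (hM i).nontrivial
  let b := fun i => Module.finBasis k (M i).V
  let B := Basis.piTensorProduct b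
  rw [isIrreducible_iff]
  constructor
  · have : ∀ i, ∃ m : (M i).V, m ≠ 0 := fun i => exists_ne 0
    have hd : ∀ i, Nonempty (Fin (Module.finrank k (M i).V)) := fun i =>
      (b i).index_nonempty
    exact ⟨B fun i => (hd i).some, 0, B.ne_zero _⟩
  · intro W hW
    rw [or_iff_not_imp_left]
    intro hbot
    obtain ⟨t, htW, ht⟩ := W.ne_bot_iff.1 hbot
    -- By Burnside the operators `(M i).ρ a` generate all endomorphisms of the `i`-th factor, and
    -- `hL` realizes each of them by an element acting in that place only.
    have h1 : ∀ i f, ∀ t ∈ W, tensorSingle M i f t ∈ W := by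
      intro i f
      have hf : f ∈ Algebra.adjoin k (Set.range (M i).ρ) := by
        rw [(hM i).adjoin_range]; trivial
      induction hf using Algebra.adjoin_induction with
      | mem x hx =>
        obtain ⟨a, rfl⟩ := hx
        obtain ⟨b, hb, hb'⟩ := hL i a
        intro t ht
        rw [← hb, ← tensor_ρ_eq_tensorSingle M i b hb']
        exact hW b t ht
      | algebraMap r =>
        intro t ht
        rw [← tensorSingleHom_apply, AlgHom.commutes]
        exact W.smul_mem r ht
      | add x y _ _ hx hy =>
        intro t ht
        rw [tensorSingle_add]
        exact W.add_mem (hx t ht) (hy t ht)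
      | mul x y _ _ hx hy =>
        intro t ht
        rw [tensorSingle_mul]
        exact hx _ (hy t ht)
    obtain ⟨p, hp⟩ : ∃ p, B.repr t p ≠ 0 := by
      by_contra! h
      exact ht ((B.repr.map_eq_zero_iff).1 (Finsupp.ext h))
    -- The tensor product of the rank-one operators `x ↦ (b i).coord (p i) x • m i` sends `t` to its
    -- nonzero `p`-coordinate times the pure tensor of `m`.
    have h2 : ∀ m : ∀ i, (M i).V, PiTensorProduct.tprod k m ∈ W := by
      intro m
      have key : PiTensorProduct.map (fun i => ((b i).coord (p i)).smulRight (m i)) t =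
          B.repr t p • PiTensorProduct.tprod k m := by
        clear hp ht htW
        induction t using PiTensorProduct.induction_on with
        | add x y hx hy => rw [map_add, hx, hy, map_add, Finsupp.add_apply, add_smul]
        | smul_tprod c x =>
          rw [map_smul, PiTensorProduct.map_tprod, map_smul, Finsupp.smul_apply, smul_assoc]
          congr 1
          rw [Basis.piTensorProduct_repr_tprod_apply]
          exact MultilinearMap.map_smul_univ _ _ _
      have := map_mem_of_tensorSingle_mem M W h1
        (fun i => ((b i).coord (p i)).smulRight (m i)) htW
      rw [key] at this
      exact (W.smul_mem_iff hp).1 this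
    rw [eq_top_iff]
    intro x _
    induction x using PiTensorProduct.induction_on with
    | add x y hx hy => exact W.add_mem (hx ⟨⟩) (hy ⟨⟩)
    | smul_tprod c m => exact W.smul_mem c (h2 m)

end TensorProducts

end LieFDRep

/-! ### Comparing tensor products factor by factor. -/

namespace LieFDRep

section Cancellation

/-- In the tensor product basis, the coordinates of a pure tensor are products of coordinates of its
entries; some such product has no zero factor. -/
theorem tprod_ne_zero {k : Type u} [Field k] {L : Type v} [LieRing L] [LieAlgebra k L]
    {ι : Type w₁} [Fintype ι] (M : ι → LieFDRep.{u, v, w} k L) (m : ∀ i, (M i).V)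
    (hm : ∀ i, m i ≠ 0) :
    PiTensorProduct.tprod k m ≠ 0 := by
  intro h0
  let B := Basis.piTensorProduct fun i => Module.finBasis k (M i).V
  have : ∀ i, ∃ p, (Module.finBasis k (M i).V).repr (m i) p ≠ 0 := by
    intro i
    by_contra! h
    exact hm i (((Module.finBasis k (M i).V).repr.map_eq_zero_iff).1 (Finsupp.ext h))
  choose p hp using this
  have h1 : B.repr (PiTensorProduct.tprod k m) p = 0 := by rw [h0, map_zero]; rfl
  rw [Basis.piTensorProduct_repr_tprod_apply] at h1
  exact Finset.prod_ne_zero_iff.2 (fun i _ => hp i) h1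


variable {k : Type u} [Field k] {L : Type v} [LieRing L] [LieAlgebra k L]
  {ι : Type w₁} [DecidableEq ι] [Fintype ι]

/-- A nonzero equivariant multilinear map from irreducible factors to an irreducible representation
identifies the latter with the tensor product. -/
theorem mk_tensor_eq_of_multilinearMap (M : ι → LieFDRep.{u, v, w} k L)
    (N : LieFDRep.{u, v, max u w w₁} k L) (hM : (tensor M).IsIrreducible) (hN : N.IsIrreducible)
    (F : MultilinearMap k (fun i => (M i).V) N.V)
    (hF : ∀ a m, ∑ i, F (Function.update m i ((M i).ρ a (m i))) = N.ρ a (F m))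
    {m₁ : ∀ i, (M i).V} (h₁ : F m₁ ≠ 0) : RepClass.mk (tensor M) = RepClass.mk N := by
  let f : (⨂[k] i, (M i).V) →ₗ[k] N.V := PiTensorProduct.lift F
  have hf : ∀ m, f (PiTensorProduct.tprod k m) = F m := fun m => PiTensorProduct.lift.tprod m
  refine mk_eq_of_hom_ne_zero hM hN f (fun a m => ?_) fun h0 => h₁ ?_
  · have key : f ∘ₗ (∑ i, tensorSingle M i ((M i).ρ a)) = N.ρ a ∘ₗ f := by
      ext m
      simp only [LinearMap.compMultilinearMap_apply, LinearMap.comp_apply, LinearMap.sum_apply,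
        map_sum, tensorSingle_tprod, hf, hF]
    exact LinearMap.congr_fun key m
  · rw [← hf, show f = 0 from h0]; rfl

/-- Factors with a nonzero invariant vector may be dropped from an irreducible tensor product. -/
theorem mk_tensor_subtype (M : ι → LieFDRep.{u, v, w} k L) (p : ι → Prop) [DecidablePred p]
    (m₀ : ∀ i, (M i).V) (hm₀ : ∀ i, ¬ p i → ∀ a, (M i).ρ a (m₀ i) = 0)
    (hne : ∀ i, m₀ i ≠ 0)
    (hM : (tensor M).IsIrreducible) (hM' : (tensor fun i : {i // p i} => M i).IsIrreducible) :
    RepClass.mk (tensor fun i : {i // p i} => M i) = RepClass.mk (tensor M) := by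
  -- Padding with the invariant vectors `m₀` embeds the smaller tensor product; the padded places
  -- contribute nothing to the action.
  let ext : (∀ i : {i // p i}, (M i).V) → ∀ i, (M i).V :=
    fun m i => if h : p i then m ⟨i, h⟩ else m₀ i
  have hext : ∀ m (i : {i // p i}) x, ext (Function.update m i x) =
      Function.update (ext m) i.1 x := by
    intro m i x
    funext j
    by_cases hj : j = i.1
    · subst hj; simp [ext, i.2]
    · by_cases hpj : p j
      · have : (⟨j, hpj⟩ : {i // p i}) ≠ i := fun h => hj (congrArg Subtype.val h)
        simp [ext, hpj, hj, this]
      · simp [ext, hpj, hj]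
  have hext1 : ∀ m (i : {i // p i}), ext m i.1 = m i := fun m i => by simp [ext, i.2]
  let F : MultilinearMap k (fun i : {i // p i} => (M i).V) (⨂[k] i, (M i).V) :=
    MultilinearMap.mk' (fun m => PiTensorProduct.tprod k (ext m))
      (fun m i x y => by simp only [hext]; exact MultilinearMap.map_update_add _ _ _ _ _)
      (fun m i c x => by simp only [hext]; exact MultilinearMap.map_update_smul _ _ _ _ _)
  have hF : ∀ m, F m = PiTensorProduct.tprod k (ext m) := fun _ => rfl
  refine mk_tensor_eq_of_multilinearMap _ (tensor M) hM' hM F (fun a m => ?_)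
    (m₁ := fun i => m₀ i) ?_
  · refine Eq.trans ?_ (tensor_ρ_tprod M a (ext m)).symm
    change ∑ i, F (Function.update m i ((M i).ρ a (m i))) = _
    simp only [hF, hext]
    have h1 := Finset.sum_subtype (F := inferInstance) (Finset.univ.filter p) (p := p) (by simp)
      (fun i => PiTensorProduct.tprod k (Function.update (ext m) i ((M i).ρ a (ext m i))))
    simp only [hext1] at h1
    rw [← h1]
    refine Finset.sum_subset (Finset.subset_univ _) ?_
    · intro i _ hi
      have hi : ¬ p i := by simpa using hi
      have : ext m i = m₀ i := by simp [ext, hi]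
      rw [this, hm₀ i hi]
      exact (PiTensorProduct.tprod k).map_update_zero (ext m) i
  · refine tprod_ne_zero M _ fun i => ?_
    by_cases h : p i <;> simp [ext, h, hne]

/-- An external tensor product of irreducible representations determines its factors. -/
theorem mk_eq_of_mk_tensor_eq (M N : ι → LieFDRep.{u, v, w} k L)
    (hM : ∀ i, (M i).IsIrreducible) (hN : ∀ i, (N i).IsIrreducible)
    (h : RepClass.mk (tensor M) = RepClass.mk (tensor N)) (i : ι)
    (hL : ∀ a, ∃ b, (M i).ρ b = (M i).ρ a ∧ (N i).ρ b = (N i).ρ a ∧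
      ∀ j ≠ i, (M j).ρ b = 0 ∧ (N j).ρ b = 0) :
    RepClass.mk (M i) = RepClass.mk (N i) := by
  obtain ⟨e⟩ : Nonempty ((tensor M).V ≃ₗ⁅k,L⁆ (tensor N).V) := Quotient.exact h
  have he : ∀ a t, e ((tensor M).ρ a t) = (tensor N).ρ a (e t) :=
    fun a t => e.toLieModuleHom.map_lie a t
  have hnt : ∀ i, Nontrivial (M i).V := fun i => (hM i).nontrivial
  choose m₀ hm₀ using fun i => exists_ne (0 : (M i).V)
  let b := fun i => Module.finBasis k (N i).V
  let B := Basis.piTensorProduct b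
  have ht : (PiTensorProduct.tprod k m₀ : ⨂[k] i, (M i).V) ≠ 0 := tprod_ne_zero M m₀ hm₀
  have het : e (PiTensorProduct.tprod k m₀) ≠ 0 := fun h0 =>
    ht (e.injective (h0.trans (map_zero e.toLieModuleHom).symm))
  obtain ⟨p, hp⟩ : ∃ p, B.repr (e (PiTensorProduct.tprod k m₀)) p ≠ 0 := by
    by_contra! h
    exact het ((B.repr.map_eq_zero_iff).1 (Finsupp.ext h))
  have hP1 : ∀ (m : ∀ i, (N i).V) x, ∏ j ∈ Finset.univ.erase i,
      (b j).coord (p j) (Function.update m i x j) =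
      ∏ j ∈ Finset.univ.erase i, (b j).coord (p j) (m j) := fun m x =>
    Finset.prod_congr rfl fun j hj => by rw [Function.update_of_ne (Finset.ne_of_mem_erase hj)]
  have hP2 : ∀ l ≠ i, ∀ (m : ∀ i, (N i).V) x, ∏ j ∈ Finset.univ.erase i,
      (b j).coord (p j) (Function.update m l x j) = (b l).coord (p l) x *
      ∏ j ∈ (Finset.univ.erase i).erase l, (b j).coord (p j) (m j) := fun l hl m x => by
    rw [← Finset.mul_prod_erase _ _ (Finset.mem_erase.2 ⟨hl, Finset.mem_univ l⟩),
      Function.update_self]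
    congr 1
    exact Finset.prod_congr rfl fun j hj => by
      rw [Function.update_of_ne (Finset.ne_of_mem_erase hj)]
  -- Contraction onto the `i`-th factor: all other places are evaluated on the coordinate
  -- functionals of `p`. It commutes with operators in the `i`-th place.
  let C : MultilinearMap k (fun i => (N i).V) (N i).V :=
    MultilinearMap.mk' (fun n => (∏ j ∈ Finset.univ.erase i, (b j).coord (p j) (n j)) • n i)
      (fun m l x y => by
        by_cases hl : l = i
        · subst hl; simp only [hP1, Function.update_self, smul_add]
        · simp only [hP2 l hl, Function.update_of_ne (Ne.symm hl), map_add, add_mul, add_smul])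
      (fun m l c x => by
        by_cases hl : l = i
        · subst hl; simp only [hP1, Function.update_self, smul_comm c]
        · simp only [hP2 l hl, Function.update_of_ne (Ne.symm hl), map_smul, smul_eq_mul,
            mul_assoc, mul_smul])
  have hC : ∀ n, C n = (∏ j ∈ Finset.univ.erase i, (b j).coord (p j) (n j)) • n i := fun _ => rfl
  let c : (⨂[k] i, (N i).V) →ₗ[k] (N i).V := PiTensorProduct.lift C
  let f : (M i).V →ₗ[k] (N i).V := c ∘ₗ e.toLinearEquiv.toLinearMap ∘ₗ
    ((PiTensorProduct.tprod k).toLinearMap m₀ i)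
  -- As the `p`-coordinate of the image of the pure tensor of `m₀` is nonzero, this identity shows
  -- that `f (m₀ i)` is nonzero.
  have hc : ∀ t, (b i).coord (p i) (c t) = B.repr t p := by
    intro t
    induction t using PiTensorProduct.induction_on with
    | add x y hx hy => rw [map_add, map_add, hx, hy, map_add, Finsupp.add_apply]
    | smul_tprod r n =>
      rw [map_smul, map_smul, map_smul, Finsupp.smul_apply]
      congr 1
      rw [Basis.piTensorProduct_repr_tprod_apply, ← Finset.mul_prod_erase _ _ (Finset.mem_univ i),
        PiTensorProduct.lift.tprod, mul_comm]
      exact map_smul _ _ _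
  have hcs : ∀ g t, c (tensorSingle N i g t) = g (c t) := by
    intro g t
    induction t using PiTensorProduct.induction_on with
    | add x y hx hy => rw [map_add, map_add, hx, hy, map_add, map_add]
    | smul_tprod r n =>
      rw [map_smul, map_smul, map_smul, map_smul, tensorSingle_tprod, PiTensorProduct.lift.tprod,
        PiTensorProduct.lift.tprod]
      rw [hC, hC, hP1, Function.update_self, map_smul]
  have hfx : ∀ x, f x = c (e (PiTensorProduct.tprod k (Function.update m₀ i x))) := fun _ => rfl
  refine mk_eq_of_hom_ne_zero (hM i) (hN i) f (fun a x => ?_) fun h0 => hp ?_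
  · obtain ⟨a', h1, h2, h3⟩ := hL a
    have := he a' (PiTensorProduct.tprod k (Function.update m₀ i x))
    rw [tensor_ρ_eq_tensorSingle M i a' fun j hj => (h3 j hj).1,
      tensor_ρ_eq_tensorSingle N i a' fun j hj => (h3 j hj).2] at this
    rw [h1, h2] at this
    rw [hfx, hfx]
    refine (Eq.trans ?_ (congrArg c this)).trans (hcs _ _)
    have h4 := tensorSingle_tprod M i ((M i).ρ a) (Function.update m₀ i x)
    rw [Function.update_idem, Function.update_self] at h4
    exact congrArg (fun t => c (e t)) h4.symm
  · have := hfx (m₀ i)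
    rw [Function.update_eq_self, h0] at this
    exact (hc _).symm.trans ((congrArg _ this.symm).trans (map_zero _))

end Cancellation

end LieFDRep

/-! ### Splitting a representation of a product into tensor factors. -/

/-- Let `σ a`, `a ∈ X`, together with operators commuting with them act irreducibly on `V`, and let
`W ⊆ V` be invariant under the `σ a`, with restrictions `τ a` that generate `End W`. Then
`τ a ↦ σ a` extends to `End W → End V`. -/
theorem Module.End.exists_algHom_extending_restriction {k : Type*} [Field k]
    {V W : Type*} [AddCommGroup V] [Module k V]
    [AddCommGroup W] [Module k W] [Nontrivial W] {X : Type*} (σ : X → Module.End k V)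
    (τ : X → Module.End k W) (j : W →ₗ[k] V) (hj : Function.Injective j)
    (hjτ : ∀ a w, j (τ a w) = σ a (j w)) (C : Set (Module.End k V))
    (hC : ∀ c ∈ C, ∀ a, c * σ a = σ a * c)
    (hV : ∀ U : Submodule k V, (∀ a, ∀ u ∈ U, σ a u ∈ U) → (∀ c ∈ C, ∀ u ∈ U, c u ∈ U) →
      U = ⊥ ∨ U = ⊤)
    (hτ : Algebra.adjoin k (Set.range τ) = ⊤) :
    ∃ θ : Module.End k W →ₐ[k] Module.End k V, (∀ a, θ (τ a) = σ a) ∧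
      ∀ c ∈ C, ∀ f, c * θ f = θ f * c := by
  -- `G` will be the graph of `θ`, read from right to left: its projection to `End W` is shown to be
  -- bijective.
  let G := Algebra.adjoin k (Set.range fun a => (σ a, τ a))
  have hGσ : ∀ a, (σ a, τ a) ∈ G := fun a => Algebra.subset_adjoin ⟨a, rfl⟩
  have hGj : ∀ g ∈ G, ∀ w, j (g.2 w) = g.1 (j w) := by
    intro g hg
    induction hg using Algebra.adjoin_induction with
    | mem x hx => obtain ⟨a, rfl⟩ := hx; exact hjτ a
    | algebraMap r => intro w; simp [Algebra.algebraMap_eq_smul_one]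
    | add x y _ _ hx hy => intro w; simp [hx, hy]
    | mul x y _ _ hx hy => intro w; simp [hx, hy]
  have hGC : ∀ g ∈ G, ∀ c ∈ C, c * g.1 = g.1 * c := by
    intro g hg c hc
    induction hg using Algebra.adjoin_induction with
    | mem x hx => obtain ⟨a, rfl⟩ := hx; exact hC c hc a
    | algebraMap r => exact (Algebra.commutes r c).symm
    | add x y _ _ hx hy => rw [Prod.fst_add, mul_add, add_mul, hx, hy]
    | mul x y _ _ hx hy => rw [Prod.fst_mul, ← mul_assoc, hx, mul_assoc, hy, mul_assoc]
  let π : G →ₐ[k] Module.End k W := (AlgHom.snd k _ _).comp G.val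
  have hsurj : Function.Surjective π := by
    intro f
    have hf : f ∈ Algebra.adjoin k (Set.range τ) := by rw [hτ]; trivial
    suffices f ∈ π.range from this
    refine Algebra.adjoin_le ?_ hf
    rintro _ ⟨a, rfl⟩
    exact ⟨⟨_, hGσ a⟩, rfl⟩
  have hinj : Function.Injective π := by
    rw [injective_iff_map_eq_zero]
    rintro ⟨g, hg⟩ h0
    have h0 : g.2 = 0 := h0
    -- The common kernel of all `x` with `(x, 0) ∈ G` is stable under the `σ a` and under `C`, and
    -- it contains the image of `j`; so it is all of `V`, and every such `x` is 0.
    let S : Submodule k V :=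
      { carrier := {v | ∀ x, ((x, 0) : Module.End k V × Module.End k W) ∈ G → x v = 0}
        add_mem' := fun ha hb x hx => by rw [map_add, ha x hx, hb x hx, add_zero]
        zero_mem' := fun x _ => map_zero x
        smul_mem' := fun c v hv x hx => by rw [map_smul, hv x hx, smul_zero] }
    have hS : S = ⊤ := by
      refine (hV S (fun a v hv x hx => ?_) fun c hc v hv x hx => ?_).resolve_left ?_
      · refine hv (x * σ a) ?_
        have := G.mul_mem hx (hGσ a)
        rwa [Prod.mk_mul_mk, zero_mul] at this
      · have := LinearMap.congr_fun (hGC _ hx c hc) v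
        exact this.symm.trans ((congrArg c (hv x hx)).trans (map_zero c))
      · obtain ⟨w, hw⟩ := exists_ne (0 : W)
        refine fun h => hw (hj ?_)
        rw [map_zero, ← Submodule.mem_bot k, ← h]
        intro x hx
        rw [← hGj _ hx]
        exact map_zero j
    have h1 : g.1 = 0 := by
      ext v
      have hv : v ∈ S := hS ▸ Submodule.mem_top
      exact hv g.1 (by rwa [← h0])
    exact Subtype.ext (Prod.ext h1 h0)
  let e := AlgEquiv.ofBijective π ⟨hinj, hsurj⟩
  refine ⟨((AlgHom.fst k _ _).comp G.val).comp e.symm.toAlgHom, fun a => ?_, fun c hc f => ?_⟩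
  · have : e.symm (τ a) = ⟨_, hGσ a⟩ := e.symm_apply_eq.2 rfl
    change (e.symm (τ a)).1.1 = σ a
    rw [this]
  · exact hGC _ (e.symm f).2 c hc

namespace LieFDRep

section Factorization

attribute [local instance 100] LieRing.ofAssociativeRing

variable {k : Type u} [Field k] {L : Type v} [LieRing L] [LieAlgebra k L]

theorem exists_irreducible_subrep (M : LieFDRep.{u, v, w} k L) [Nontrivial M.V] :
    ∃ (W : LieFDRep.{u, v, w} k L) (j : W.V →ₗ[k] M.V), W.IsIrreducible ∧
      Function.Injective j ∧ ∀ a w, j (W.ρ a w) = M.ρ a (j w) := by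
  obtain ⟨N, hN, -⟩ := (eq_bot_or_exists_atom_le (⊤ : LieSubmodule k L M.V)).resolve_left
    top_ne_bot
  refine ⟨{ V := N, ρ := LieModule.toEnd k L N }, N.toSubmodule.subtype, ?_,
    Subtype.val_injective, fun a w => rfl⟩
  rw [isIrreducible_iff]
  refine ⟨(LieSubmodule.nontrivial_iff_ne_bot k L M.V).2 hN.1, fun U hU => ?_⟩
  let N' : LieSubmodule k L M.V := { U.map N.toSubmodule.subtype with
    lie_mem := fun {a m} hm => by
      obtain ⟨w, hw, rfl⟩ := hm
      exact ⟨_, hU a w hw, rfl⟩ }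
  have hN' : N' ≤ N := by
    rintro _ ⟨w, -, rfl⟩
    exact w.2
  refine (hN.le_iff.1 hN').imp (fun h => ?_) fun h => ?_
  · rw [eq_bot_iff]
    intro w hw
    have : N.toSubmodule.subtype w ∈ N' := ⟨w, hw, rfl⟩
    rw [h] at this
    exact Subtype.ext ((LieSubmodule.mem_bot _).1 this)
  · rw [eq_top_iff]
    intro w _
    have : w.1 ∈ N' := by rw [h]; exact w.2
    obtain ⟨w', hw', h'⟩ := this
    exact (Subtype.ext h' : w' = w) ▸ hw'

variable {ι : Type w₁} [Fintype ι] [DecidableEq ι] {L' : ι → Type w₂} [∀ i, LieRing (L' i)]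
  [∀ i, LieAlgebra k (L' i)]

/-- An irreducible representation that factors through a finite product of Lie algebras is an
external tensor product of irreducible representations. -/
theorem exists_mk_eq_tensor [IsAlgClosed k] (p : ∀ i, L →ₗ⁅k⁆ L' i)
    (hp : ∀ i a, ∃ b, p i b = a ∧ ∀ j ≠ i, p j b = 0)
    (V : LieFDRep.{u, v, max u w w₁} k L) (hV : V.IsIrreducible)
    (hker : ∀ b, (∀ i, p i b = 0) → V.ρ b = 0) :
    ∃ W : ∀ i, LieFDRep.{u, w₂, max u w w₁} k (L' i), (∀ i, (W i).IsIrreducible) ∧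
      RepClass.mk V = RepClass.mk (tensor fun i => (W i).pullback (p i)) := by
  choose s hs hs' using hp
  have hV' := V.isIrreducible_iff.1 hV
  have hnt := hV'.1
  have hcongr : ∀ b b', (∀ i, p i b = p i b') → V.ρ b = V.ρ b' := fun b b' h => by
    rw [← sub_eq_zero, ← map_sub]
    exact hker _ fun i => by rw [map_sub, h, sub_self]
  -- The section `s i` is linear and multiplicative only modulo the common kernel of the `p i`;
  -- since `V` kills this kernel, composing `V.ρ` with `s i` gives a representation.
  let V' : ∀ i, LieFDRep.{u, w₂, max u w w₁} k (L' i) := fun i =>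
    { V := V.V
      ρ :=
        { toFun := fun a => V.ρ (s i a)
          map_add' := fun a b => by
            rw [← map_add]
            refine hcongr _ _ fun j => ?_
            by_cases h : j = i
            · subst h; simp [hs]
            · simp [hs' _ _ _ h]
          map_smul' := fun c a => by
            rw [← map_smul]
            refine hcongr _ _ fun j => ?_
            by_cases h : j = i
            · subst h; simp [hs]
            · simp [hs' _ _ _ h]
          map_lie' := fun {a b} => by
            rw [← LieHom.map_lie]
            refine hcongr _ _ fun j => ?_
            by_cases h : j = i
            · subst h; simp [hs]
            · simp [hs' _ _ _ h] } }
  have hcomm : ∀ i j, i ≠ j → ∀ a b, V.ρ (s i a) * V.ρ (s j b) = V.ρ (s j b) * V.ρ (s i a) := by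
    intro i j hij a b
    rw [← sub_eq_zero, ← LieRing.of_associative_ring_bracket, ← LieHom.map_lie]
    refine hker _ fun l => ?_
    rw [LieHom.map_lie]
    by_cases h : l = i
    · rw [hs' j b l (h ▸ hij), lie_zero]
    · rw [hs' i a l h, zero_lie]
  have hsum : ∀ a, V.ρ a = ∑ i, V.ρ (s i (p i a)) := by
    intro a
    rw [← map_sum]
    refine hcongr _ _ fun i => ?_
    rw [map_sum, Finset.sum_eq_single i (fun j _ hj => hs' j _ i hj.symm) (by simp), hs]
  have : ∀ i, Nontrivial (V' i).V := fun i => hnt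
  choose W j hW hj hjW using fun i => (V' i).exists_irreducible_subrep
  have hWnt : ∀ i, Nontrivial (W i).V := fun i => (hW i).nontrivial
  -- Different places commute, so the action of the `i`-th algebra on `V` factors through the
  -- endomorphisms of an irreducible subrepresentation `W i`.
  have hθ := fun i => Module.End.exists_algHom_extending_restriction (k := k) (V := V.V)
    (fun a => V.ρ (s i a))
    (W i).ρ (j i) (hj i) (hjW i) {c | ∃ l ≠ i, ∃ b, V.ρ (s l b) = c}
    (by rintro _ ⟨l, hl, b, rfl⟩ a; exact hcomm l i hl b a)
    (fun U h1 h2 => hV'.2 U fun a u hu => by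
      rw [hsum, LinearMap.sum_apply]
      refine U.sum_mem fun l _ => ?_
      by_cases hl : l = i
      · subst hl; exact h1 _ u hu
      · exact h2 _ ⟨l, hl, _, rfl⟩ u hu)
    (hW i).adjoin_range
  choose θ hθσ hθc using hθ
  -- The multilinear map is built one place at a time. Adding place `l` applies `θ l` of the
  -- rank-one operator with value vector `m l`; since `ρ a` composed with it has value vector `ρ a
  -- (m l)`, this is equivariant in place `l`.
  have hmain : ∀ t : Finset ι, ∃ F : (∀ i, (W i).V) → V.V, (∃ m, F m ≠ 0) ∧
      (∀ i ∈ t, ∀ m x y, F (Function.update m i (x + y)) =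
        F (Function.update m i x) + F (Function.update m i y)) ∧
      (∀ i ∈ t, ∀ m (c : k) x, F (Function.update m i (c • x)) = c • F (Function.update m i x)) ∧
      (∀ i ∈ t, ∀ m a, F (Function.update m i ((W i).ρ a (m i))) = V.ρ (s i a) (F m)) ∧
      ∀ i ∉ t, ∀ m x, F (Function.update m i x) = F m := by
    intro t
    induction t using Finset.induction_on with
    | empty =>
      obtain ⟨v, hv⟩ := exists_ne (0 : V.V)
      exact ⟨fun _ => v, ⟨0, hv⟩, by simp, by simp, by simp, by simp⟩
    | insert l t hl ih =>
      obtain ⟨F, ⟨m, hm⟩, hadd, hsmul, hequiv, hconst⟩ := ih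
      let b := Module.finBasis k (W l).V
      have h1 : ∑ q, (b.coord q).smulRight (b q) = (1 : Module.End k (W l).V) := by
        ext x
        simp [b.sum_repr]
      -- The identity is a sum of rank-one operators, and `θ l 1 = 1`, so at least one of the
      -- summands does not kill `F m`.
      obtain ⟨q, hq⟩ : ∃ q, θ l ((b.coord q).smulRight (b q)) (F m) ≠ 0 := by
        by_contra! h
        apply hm
        have := LinearMap.congr_fun (congrArg (θ l) h1) (F m)
        rw [map_sum, LinearMap.sum_apply, Finset.sum_congr rfl fun q _ => h q, map_one] at this
        simpa using this.symm
      have hφ : ∀ x y : (W l).V, (b.coord q).smulRight (x + y) =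
          (b.coord q).smulRight x + (b.coord q).smulRight y := fun x y => by ext; simp
      have hφ' : ∀ (c : k) (x : (W l).V), (b.coord q).smulRight (c • x) =
          c • (b.coord q).smulRight x := fun c x => by ext; simp [smul_comm c]
      have hφρ : ∀ a (x : (W l).V), (b.coord q).smulRight ((W l).ρ a x) =
          (W l).ρ a * (b.coord q).smulRight x := fun a x => by ext; simp
      refine ⟨fun m => θ l ((b.coord q).smulRight (m l)) (F m),
        ⟨Function.update m l (b q), ?_⟩, ?_, ?_, ?_, ?_⟩
      · simp only [Function.update_self, hconst l hl]
        exact hq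
      · intro i hi m x y
        by_cases hil : i = l
        · subst hil
          simp only [Function.update_self, hconst i hl, hφ, map_add, LinearMap.add_apply]
        · simp only [Function.update_of_ne (Ne.symm hil),
            hadd i (Finset.mem_of_mem_insert_of_ne hi hil), map_add]
      · intro i hi m c x
        by_cases hil : i = l
        · subst hil
          simp only [Function.update_self, hconst i hl, hφ', map_smul, LinearMap.smul_apply]
        · simp only [Function.update_of_ne (Ne.symm hil),
            hsmul i (Finset.mem_of_mem_insert_of_ne hi hil), map_smul]
      · intro i hi m a
        by_cases hil : i = l
        · subst hil
          simp only [Function.update_self, hconst i hl, hφρ, map_mul, hθσ]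
          rfl
        · simp only [Function.update_of_ne (Ne.symm hil),
            hequiv i (Finset.mem_of_mem_insert_of_ne hi hil)]
          exact (LinearMap.congr_fun (hθc l _ ⟨i, hil, a, rfl⟩ _) (F m)).symm
      · intro i hi m x
        rw [Finset.mem_insert, not_or] at hi
        simp only [Function.update_of_ne (Ne.symm hi.1), hconst i hi.2]
  obtain ⟨F, ⟨m, hm⟩, hadd, hsmul, hequiv, -⟩ := hmain Finset.univ
  refine ⟨W, hW, (mk_tensor_eq_of_multilinearMap _ V ?_ hV
    (MultilinearMap.mk' F (fun m i => hadd i (Finset.mem_univ i) m)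
      fun m i => hsmul i (Finset.mem_univ i) m) (fun a m => ?_) hm).symm⟩
  · refine isIrreducible_tensor _ (fun i => ?_) fun i a => ⟨s i (p i a), ?_, fun l hl => ?_⟩
    · exact ((W i).isIrreducible_pullback (p i) fun a => ⟨s i a, hs i a⟩).2 (hW i)
    · exact congrArg (W i).ρ (hs i _)
    · exact (congrArg (W l).ρ (hs' i _ l hl)).trans (map_zero _)
  · rw [hsum, LinearMap.sum_apply]
    exact Finset.sum_congr rfl fun i _ => hequiv i (Finset.mem_univ i) m (p i a)

end Factorization

end LieFDRep

/-! ### Orbit representatives and evaluation at finitely many points. -/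

theorem MulAction.exists_finset_orbit_representatives {G X : Type*} [Group G] [MulAction G X]
    (Y : Set X) (hY : ((Quotient.mk _ : X → MulAction.orbitRel.Quotient G X) '' Y).Finite) :
    ∃ S : Finset X, (∀ x ∈ S, x ∈ Y) ∧ (∀ x ∈ S, ∀ y ∈ S, x ∈ MulAction.orbit G y → x = y) ∧
      ∀ y ∈ Y, ∃ x ∈ S, x ∈ MulAction.orbit G y := by
  classical
  let q : X → MulAction.orbitRel.Quotient G X := Quotient.mk _
  have hq : ∀ x y, q x = q y ↔ x ∈ MulAction.orbit G y := fun x y => by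
    rw [← MulAction.orbitRel_apply]; exact Quotient.eq
  have hT : ∀ c : hY.toFinset, ∃ x ∈ Y, q x = c := fun c => hY.mem_toFinset.1 c.2
  choose r hr hrq using hT
  refine ⟨Finset.univ.image r, fun x hx => ?_, fun x hx y hy hxy => ?_, fun y hy => ?_⟩
  · obtain ⟨c, -, rfl⟩ := Finset.mem_image.1 hx
    exact hr c
  · obtain ⟨c, -, rfl⟩ := Finset.mem_image.1 hx
    obtain ⟨d, -, rfl⟩ := Finset.mem_image.1 hy
    congr 1
    exact Subtype.ext ((hrq c).symm.trans (((hq _ _).2 hxy).trans (hrq d)))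
  · have hc : q y ∈ hY.toFinset := hY.mem_toFinset.2 ⟨y, hy, rfl⟩
    exact ⟨r ⟨q y, hc⟩, Finset.mem_image_of_mem r (Finset.mem_univ _), (hq _ _).1 (hrq ⟨q y, hc⟩)⟩

section Points

variable {k : Type u} [Field k] {A : Type v} [CommRing A] [Algebra k A]

/-- Two distinct points differ on some function, which an affine change normalizes to the values 1
and 0; the product over `s` handles all points at once. -/
theorem RatPoint.exists_eval_eq_one (x : RatPoint k A) (s : Finset (RatPoint k A)) (hx : x ∉ s) :
    ∃ f : A, x.eval f = 1 ∧ ∀ y ∈ s, y.eval f = 0 := by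
  have h : ∀ y : RatPoint k A, ∃ f : A, y ≠ x → x.eval f = 1 ∧ y.eval f = 0 := by
    intro y
    by_cases hy : y = x
    · exact ⟨0, fun h => (h hy).elim⟩
    · obtain ⟨g, hg⟩ : ∃ g, y.eval g ≠ x.eval g := by
        by_contra! h
        exact hy (AlgHom.ext h)
      refine ⟨(x.eval g - y.eval g)⁻¹ • (g - algebraMap k A (y.eval g)), fun _ => ⟨?_, ?_⟩⟩
      · rw [map_smul, map_sub, AlgHom.commutes, smul_eq_mul]
        exact inv_mul_cancel₀ (sub_ne_zero.2 (Ne.symm hg))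
      · rw [map_smul, map_sub, AlgHom.commutes, Algebra.algebraMap_self_apply, sub_self, smul_zero]
  choose f hf using h
  refine ⟨∏ y ∈ s, f y, ?_, fun y hy => ?_⟩
  · rw [map_prod]
    exact Finset.prod_eq_one fun y hy => (hf y fun h => hx (h ▸ hy)).1
  · rw [map_prod]
    exact Finset.prod_eq_zero hy (hf y fun h => hx (h ▸ hy)).2

end Points

section EvaluationSurjective

variable {k : Type u} [Field k] {Γ : Type w₁} [Group Γ]
  {A : Type v} [CommRing A] [Algebra k A] [MulSemiringAction Γ A] [SMulCommClass Γ k A]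
  {𝔤 : Type w₂} [LieRing 𝔤] [LieAlgebra k 𝔤] [DistribMulAction Γ 𝔤] [SMulCommClass Γ k 𝔤]

theorem diagAct_mul (γ δ : Γ) (t : A ⊗[k] 𝔤) :
    diagAct k Γ A 𝔤 (γ * δ) t = diagAct k Γ A 𝔤 γ (diagAct k Γ A 𝔤 δ t) := by
  induction t using TensorProduct.induction_on with
  | zero => simp
  | add x y hx hy => simp only [map_add, hx, hy]
  | tmul f a => simp [mul_smul]

variable [IsLieAction Γ 𝔤]

theorem sum_diagAct_mem [Fintype Γ] (t : A ⊗[k] 𝔤) :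
    ∑ γ : Γ, diagAct k Γ A 𝔤 γ t ∈ EquivariantMapAlgebra k Γ A 𝔤 := by
  intro γ
  rw [map_sum]
  simp only [← diagAct_mul]
  exact Fintype.sum_equiv (Equiv.mulLeft γ) _ _ fun δ => rfl

@[simp] theorem coe_evalHom_apply (x : RatPoint k A) (α : EquivariantMapAlgebra k Γ A 𝔤) :
    (evalHom Γ x α : 𝔤) = evalLin x α.1 := rfl

/-- Evaluation at finitely many points in distinct orbits is surjective. -/
theorem exists_evalHom_eq [CharZero k] [Finite Γ] {S : Finset (RatPoint k A)}
    (hS : ∀ x ∈ S, ∀ y ∈ S, x ∈ MulAction.orbit Γ y → x = y) {x : RatPoint k A} (hx : x ∈ S)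
    (a : pointSubalgebra Γ 𝔤 x) :
    ∃ α : EquivariantMapAlgebra k Γ A 𝔤, evalHom Γ x α = a ∧
      ∀ y ∈ S, y ≠ x → evalHom Γ y α = 0 := by
  classical
  have := Fintype.ofFinite Γ
  -- `f` must vanish also at the other points of the orbit of `x`, hence all translates of points of
  -- `S` except `x` are included.
  let s := ((Finset.univ ×ˢ S).image fun p : Γ × RatPoint k A => p.1 • p.2).erase x
  obtain ⟨f, hf1, hf0⟩ := x.exists_eval_eq_one s (Finset.notMem_erase _ _)
  have hs : ∀ y ∈ S, ∀ γ : Γ, γ⁻¹ • y ≠ x → y.eval (γ • f) = 0 := by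
    intro y hy γ hγ
    have := RatPoint.eval_smul γ⁻¹ y f
    rw [inv_inv] at this
    rw [← this]
    exact hf0 _ (Finset.mem_erase.2 ⟨hγ, Finset.mem_image.2 ⟨(γ⁻¹, y), by simp [hy], rfl⟩⟩)
  have hcard : ((Finset.univ.filter (· ∈ MulAction.stabilizer Γ x)).card : k) ≠ 0 := by
    rw [Nat.cast_ne_zero]
    exact Finset.card_ne_zero.2 ⟨1, by simp⟩
  -- At `x` only the terms from the stabilizer survive, and each equals `a`; this explains the
  -- division by the order of the stabilizer.
  refine ⟨((Finset.univ.filter (· ∈ MulAction.stabilizer Γ x)).card : k)⁻¹ •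
    ⟨_, sum_diagAct_mem (f ⊗ₜ a.1)⟩, ?_, fun y hy hyx => ?_⟩
  · rw [map_smul, inv_smul_eq_iff₀ hcard]
    refine Subtype.ext ?_
    have key : ∀ γ : Γ, evalLin x (diagAct k Γ A 𝔤 γ (f ⊗ₜ a.1)) =
        if γ ∈ MulAction.stabilizer Γ x then a.1 else 0 := by
      intro γ
      rw [diagAct_tmul, evalLin_tmul]
      split_ifs with hγ
      · have := RatPoint.eval_smul γ⁻¹ x f
        rw [inv_inv] at this
        rw [← this, MulAction.mem_stabilizer_iff.1 (inv_mem hγ), hf1, one_smul, a.2 γ hγ]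
      · rw [hs x hx γ, zero_smul]
        intro h
        exact hγ (inv_smul_eq_iff.1 h).symm
    rw [coe_evalHom_apply, map_sum, Finset.sum_congr rfl fun γ _ => key γ, ← Finset.sum_filter,
      Finset.sum_const, ← Nat.cast_smul_eq_nsmul k]
    rfl
  · rw [map_smul]
    refine smul_eq_zero_of_right _ (Subtype.ext ?_)
    rw [coe_evalHom_apply, map_sum]
    refine Finset.sum_eq_zero fun γ _ => ?_
    rw [diagAct_tmul, evalLin_tmul, hs y hy γ, zero_smul]
    intro h
    exact hyx (hS x hx y hy ⟨γ⁻¹, h⟩).symm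

theorem evalHom_surjective [CharZero k] [Finite Γ] (x : RatPoint k A) :
    Function.Surjective (evalHom (𝔤 := 𝔤) Γ x) := fun a => by
  obtain ⟨α, hα, -⟩ := exists_evalHom_eq (S := {x}) (by simp) (Finset.mem_singleton_self x) a
  exact ⟨α, hα⟩

theorem isIrreducible_evalRep [IsAlgClosed k] [CharZero k] [Finite Γ] {S : Finset (RatPoint k A)}
    (hS : ∀ x ∈ S, ∀ y ∈ S, x ∈ MulAction.orbit Γ y → x = y)
    (M : ∀ x : S, LieFDRep.{u, w₂, max u v} k (pointSubalgebra Γ 𝔤 x.1))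
    (hM : ∀ x, (M x).IsIrreducible) : (evalRep Γ S M).IsIrreducible := by
  classical
  refine LieFDRep.isIrreducible_tensor _ (fun x => ?_) fun x α => ?_
  · exact ((M x).isIrreducible_pullback _ (evalHom_surjective x.1)).2 (hM x)
  · obtain ⟨β, h1, h2⟩ := exists_evalHom_eq hS x.2 (evalHom Γ x.1 α)
    refine ⟨β, congrArg (M x).ρ h1, fun y hy => ?_⟩
    exact (congrArg (M y).ρ (h2 y y.2 fun h => hy (Subtype.ext h))).trans (map_zero _)

end EvaluationSurjective

/-! ### Pullback and irreducibility of isomorphism classes. -/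

namespace RepClass

variable {k : Type u} [Field k] {L : Type v} [LieRing L] [LieAlgebra k L]
  {L' : Type w₁} [LieRing L'] [LieAlgebra k L'] {L'' : Type w₂} [LieRing L''] [LieAlgebra k L'']

theorem pullback_pullback (c : RepClass.{u, v, w} k L) (φ : L' →ₗ⁅k⁆ L) (ψ : L'' →ₗ⁅k⁆ L') :
    (c.pullback φ).pullback ψ = c.pullback (φ.comp ψ) := by
  induction c using Quotient.inductionOn with
  | h M => rfl

theorem pullback_trivial (φ : L' →ₗ⁅k⁆ L) :
    (trivial.{u, v, w} k L).pullback φ = trivial.{u, w₁, w} k L' := rfl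

theorem pullback_injective (φ : L' →ₗ⁅k⁆ L) (hφ : Function.Surjective φ) :
    Function.Injective (fun c : RepClass.{u, v, w} k L => c.pullback φ) := by
  intro c d h
  induction c using Quotient.inductionOn with
  | h M =>
  induction d using Quotient.inductionOn with
  | h N =>
  obtain ⟨e⟩ : Nonempty ((M.pullback φ).V ≃ₗ⁅k,L'⁆ (N.pullback φ).V) := Quotient.exact h
  refine Quotient.sound ⟨{ e.toLinearEquiv with map_lie' := fun {a m} => ?_ }⟩
  obtain ⟨a, rfl⟩ := hφ a
  exact e.toLieModuleHom.map_lie a m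

theorem isIrreducible_mk_iff (M : LieFDRep.{u, v, w} k L) :
    (mk M).IsIrreducible ↔ M.IsIrreducible := by
  refine ⟨fun ⟨N, hN, h⟩ => ?_, fun h => ⟨M, rfl, h⟩⟩
  obtain ⟨e⟩ : Nonempty (N.V ≃ₗ⁅k,L⁆ M.V) := Quotient.exact hN
  rw [LieFDRep.isIrreducible_iff] at h ⊢
  have := h.1
  refine ⟨e.symm.toLinearEquiv.toEquiv.nontrivial, fun W hW => ?_⟩
  have he : ∀ a m, e (N.ρ a m) = M.ρ a (e m) := fun a m => e.toLieModuleHom.map_lie a m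
  refine (h.2 (W.comap e.toLinearEquiv.toLinearMap) fun a m hm => ?_).imp (fun h => ?_) fun h => ?_
  · change e _ ∈ W
    rw [he]
    exact hW _ _ hm
  · rw [eq_bot_iff]
    intro w hw
    have : e.symm w ∈ W.comap e.toLinearEquiv.toLinearMap := by
      change e (e.symm w) ∈ W
      rwa [e.apply_symm_apply]
    rw [h, Submodule.mem_bot] at this
    rw [Submodule.mem_bot, ← e.apply_symm_apply w, this]
    exact map_zero e.toLieModuleHom
  · rw [eq_top_iff]
    intro w _
    have : e.symm w ∈ W.comap e.toLinearEquiv.toLinearMap := h ▸ Submodule.mem_top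
    change e (e.symm w) ∈ W at this
    rwa [e.apply_symm_apply] at this

theorem isIrreducible_trivial : (trivial.{u, v, w} k L).IsIrreducible := by
  refine ⟨LieFDRep.trivial k L, rfl, ?_⟩
  rw [LieFDRep.isIrreducible_iff]
  have : IsSimpleModule k (ULift.{w} k) := IsSimpleModule.congr ULift.moduleEquiv
  exact ⟨inferInstanceAs (Nontrivial (ULift.{w} k)), fun W _ =>
    eq_bot_or_eq_top (α := Submodule k (ULift.{w} k)) W⟩

theorem isIrreducible_pullback (c : RepClass.{u, v, w} k L) (φ : L' →ₗ⁅k⁆ L)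
    (hφ : Function.Surjective φ) : (c.pullback φ).IsIrreducible ↔ c.IsIrreducible := by
  induction c using Quotient.inductionOn with
  | h M =>
    exact (isIrreducible_mk_iff _).trans ((M.isIrreducible_pullback φ hφ).trans
      (isIrreducible_mk_iff _).symm)

end RepClass

/-! ### Irreducibility of `ev_Ψ` and injectivity. -/

namespace EvalParam

variable {k : Type u} [Field k] {Γ : Type w₁} [Group Γ]
  {A : Type v} [CommRing A] [Algebra k A] [MulSemiringAction Γ A] [SMulCommClass Γ k A]
  {𝔤 : Type w₂} [LieRing 𝔤] [LieAlgebra k 𝔤] [DistribMulAction Γ 𝔤] [SMulCommClass Γ k 𝔤]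
  [IsLieAction Γ 𝔤] (Ψ : EvalParam k Γ A 𝔤)

theorem toFun_injective :
    Function.Injective (EvalParam.toFun : EvalParam k Γ A 𝔤 → _) := by
  rintro ⟨f, _, _, _⟩ ⟨g, _, _, _⟩ h
  cases h
  rfl

theorem smul_mem_support {x : RatPoint k A} {γ : Γ} (h : γ • x ∈ Ψ.support) : x ∈ Ψ.support := by
  intro h0
  apply h
  rw [← Ψ.equivariant, h0]
  rfl

theorem smul_mem_support_iff {x : RatPoint k A} {γ : Γ} : γ • x ∈ Ψ.support ↔ x ∈ Ψ.support :=
  ⟨Ψ.smul_mem_support, fun h => Ψ.smul_mem_support (γ := γ⁻¹) (by rwa [inv_smul_smul])⟩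

variable [IsAlgClosed k] [CharZero k] [Finite Γ]

/-- `ev_Ψ` may be computed from any finite set of points in distinct orbits that meets every orbit
in the support. -/
theorem evalClass_eq_of_cover {S : Finset (RatPoint k A)}
    (hS : ∀ x ∈ S, ∀ y ∈ S, x ∈ MulAction.orbit Γ y → x = y)
    (hcover : ∀ y ∈ Ψ.support, ∃ x ∈ S, x ∈ MulAction.orbit Γ y)
    (M : ∀ x : S, LieFDRep.{u, w₂, max u v} k (pointSubalgebra Γ 𝔤 x.1))
    (hM : ∀ x, RepClass.mk (M x) = Ψ.toFun x.1) :
    Ψ.evalClass = RepClass.mk (evalRep Γ S M) := by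
  classical
  let T := S.filter (· ∈ Ψ.support)
  have hTS : ∀ x : T, x.1 ∈ S := fun x => (Finset.mem_filter.1 x.2).1
  have hT : Ψ.IsTransversal T := by
    refine ⟨fun x hx => (Finset.mem_filter.1 hx).2, fun y hy => ?_⟩
    obtain ⟨x, hx, hxy⟩ := hcover y hy
    refine ⟨x, ⟨Finset.mem_filter.2 ⟨hx, ?_⟩, hxy⟩, fun z hz => ?_⟩
    · obtain ⟨γ, rfl⟩ := hxy
      exact Ψ.smul_mem_support_iff.2 hy
    · refine hS z (Finset.mem_filter.1 hz.1).1 x hx ?_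
      rw [MulAction.orbit_eq_iff.2 hxy]
      exact hz.2
  have hMirr : ∀ x, (M x).IsIrreducible := fun x =>
    (RepClass.isIrreducible_mk_iff _).1 (hM x ▸ Ψ.irreducible x.1)
  rw [Ψ.evalClass_eq hT (fun x => M ⟨x.1, hTS x⟩) fun x => hM _]
  let N : S → LieFDRep.{u, max v w₂, max u v} k (EquivariantMapAlgebra k Γ A 𝔤) :=
    fun x => (M x).pullback (evalHom Γ x.1)
  let e : {x : S // x.1 ∈ Ψ.support} ≃ T :=
    { toFun := fun x => ⟨x.1.1, Finset.mem_filter.2 ⟨x.1.2, x.2⟩⟩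
      invFun := fun x => ⟨⟨x.1, hTS x⟩, (Finset.mem_filter.1 x.2).2⟩
      left_inv := fun _ => rfl
      right_inv := fun _ => rfl }
  have h1 : RepClass.mk (LieFDRep.tensor fun x : {x : S // x.1 ∈ Ψ.support} => N x.1) =
      RepClass.mk (evalRep Γ T fun x => M ⟨x.1, hTS x⟩) :=
    LieFDRep.tensor_iso _ _ e fun x => rfl
  -- Off the support the factor is trivial, so it has a nonzero invariant vector and may be dropped.
  have hm : ∀ x : S, ∃ m : (M x).V, m ≠ 0 ∧ (x.1 ∉ Ψ.support → ∀ a, (M x).ρ a m = 0) := by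
    intro x
    by_cases hx : x.1 ∈ Ψ.support
    · have := (hMirr x).nontrivial
      obtain ⟨m, hm⟩ := exists_ne (0 : (M x).V)
      exact ⟨m, hm, fun h => (h hx).elim⟩
    · have hx' : RepClass.mk (M x) = RepClass.trivial.{u, w₂, v} k (pointSubalgebra Γ 𝔤 x.1) :=
        (hM x).trans (not_not.1 hx)
      obtain ⟨e⟩ : Nonempty ((LieFDRep.trivial.{u, w₂, v} k (pointSubalgebra Γ 𝔤 x.1)).V
        ≃ₗ⁅k, pointSubalgebra Γ 𝔤 x.1⁆ (M x).V) := Quotient.exact hx'.symm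
      refine ⟨e (ULift.up 1), fun h => ?_, fun _ a => ?_⟩
      · have h2 := e.injective (h.trans (map_zero e.toLieModuleHom).symm)
        exact one_ne_zero (congrArg ULift.down h2)
      · have := e.toLieModuleHom.map_lie a (ULift.up 1)
        exact this.symm.trans (map_zero e.toLieModuleHom)
  choose m hm0 hm1 using hm
  rw [← h1]
  refine LieFDRep.mk_tensor_subtype N (fun x => x.1 ∈ Ψ.support) m (fun x hx a => hm1 x hx _) hm0
    (isIrreducible_evalRep hS M hMirr) ?_
  rw [← RepClass.isIrreducible_mk_iff, h1, RepClass.isIrreducible_mk_iff]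
  exact isIrreducible_evalRep (fun x hx y hy => hS x (hTS ⟨x, hx⟩) y (hTS ⟨y, hy⟩)) _
    fun x => hMirr _

theorem isIrreducible_evalClass : Ψ.evalClass.IsIrreducible := by
  obtain ⟨s, hs⟩ := Ψ.exists_transversal
  rw [Ψ.evalClass_eq hs (fun x => (Ψ.toFun x.1).out) fun x => Quotient.out_eq _,
    RepClass.isIrreducible_mk_iff]
  refine isIrreducible_evalRep (fun x hx y hy hxy => ?_) _ fun x => ?_
  · exact (hs.2 y (hs.1 y hy)).unique ⟨hx, hxy⟩ ⟨hy, MulAction.mem_orbit_self y⟩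
  · rw [← RepClass.isIrreducible_mk_iff]
    exact (congrArg RepClass.IsIrreducible (Quotient.out_eq (Ψ.toFun x.1))).mpr
      (Ψ.irreducible x.1)

/-- Representatives of the orbits in the union of both supports index both tensor products, so their
factors can be compared place by place. Equivariance carries equality from the representatives to
their orbits. -/
theorem evalClass_injective :
    Function.Injective (EvalParam.evalClass : EvalParam k Γ A 𝔤 → _) := by
  classical
  intro Ψ Φ h
  obtain ⟨S, -, hS, hcover⟩ := MulAction.exists_finset_orbit_representatives (G := Γ)
    (Ψ.support ∪ Φ.support) ((Ψ.finite_support.union Φ.finite_support).image _)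
  let M := fun x : S => (Ψ.toFun x.1).out
  let N := fun x : S => (Φ.toFun x.1).out
  have hM : ∀ x, RepClass.mk (M x) = Ψ.toFun x.1 := fun x => Quotient.out_eq _
  have hN : ∀ x, RepClass.mk (N x) = Φ.toFun x.1 := fun x => Quotient.out_eq _
  rw [Ψ.evalClass_eq_of_cover hS (fun y hy => hcover y (Or.inl hy)) M hM,
    Φ.evalClass_eq_of_cover hS (fun y hy => hcover y (Or.inr hy)) N hN] at h
  have hMirr : ∀ x, (M x).IsIrreducible := fun x =>
    (RepClass.isIrreducible_mk_iff _).1 (hM x ▸ Ψ.irreducible x.1)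
  have hNirr : ∀ x, (N x).IsIrreducible := fun x =>
    (RepClass.isIrreducible_mk_iff _).1 (hN x ▸ Φ.irreducible x.1)
  have hSeq : ∀ x ∈ S, Ψ.toFun x = Φ.toFun x := by
    intro x hx
    have hx' := LieFDRep.mk_eq_of_mk_tensor_eq
      (fun x : S => (M x).pullback (evalHom (𝔤 := 𝔤) Γ x.1))
      (fun x : S => (N x).pullback (evalHom (𝔤 := 𝔤) Γ x.1))
      (fun x => ((M x).isIrreducible_pullback _ (evalHom_surjective x.1)).2 (hMirr x))
      (fun x => ((N x).isIrreducible_pullback _ (evalHom_surjective x.1)).2 (hNirr x)) h ⟨x, hx⟩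
      (fun α => by
        obtain ⟨β, h1, h2⟩ := exists_evalHom_eq hS hx (evalHom Γ x α)
        refine ⟨β, congrArg (M ⟨x, hx⟩).ρ h1, congrArg (N ⟨x, hx⟩).ρ h1, fun y hy => ?_⟩
        have h3 := h2 y y.2 fun h => hy (Subtype.ext h)
        exact ⟨(congrArg (M y).ρ h3).trans (map_zero _), (congrArg (N y).ρ h3).trans (map_zero _)⟩)
    have := RepClass.pullback_injective _ (evalHom_surjective (𝔤 := 𝔤) (Γ := Γ) x)
      (a₁ := RepClass.mk (M ⟨x, hx⟩)) (a₂ := RepClass.mk (N ⟨x, hx⟩)) hx'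
    rwa [hM, hN] at this
  refine toFun_injective (funext fun y => ?_)
  by_cases hy : y ∈ Ψ.support ∪ Φ.support
  · obtain ⟨x, hx, hxy⟩ := hcover y hy
    obtain ⟨γ, rfl⟩ := MulAction.mem_orbit_symm.1 hxy
    exact (Ψ.equivariant γ x).symm.trans ((congrArg (fun c => RepClass.pullback c (pointShift γ x))
      (hSeq x hx)).trans (Φ.equivariant γ x))
  · rw [Set.mem_union, not_or] at hy
    exact (not_not.1 hy.1).trans (not_not.1 hy.2).symm

end EvalParam

/-! ### Perfect Lie algebras and semiprime kernels. -/

theorem LieAlgebra.isPerfect_iff_span {k : Type u} [CommRing k] {L : Type v} [LieRing L]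
    [LieAlgebra k L] :
    LieAlgebra.IsPerfect k L ↔ Submodule.span k {m : L | ∃ x y : L, ⁅x, y⁆ = m} = ⊤ := by
  rw [LieAlgebra.IsPerfect, ← LieSubmodule.toSubmodule_eq_top,
    LieSubmodule.lieIdeal_oper_eq_linear_span']
  simp

section Semiprime

attribute [local instance 100] LieRing.ofAssociativeRing

/-- The kernel of a finite-dimensional irreducible representation of a perfect Lie algebra is a
semiprime ideal. -/
theorem LieFDRep.IsIrreducible.apply_eq_zero_of_lie_eq_zero {k : Type u} [Field k] [IsAlgClosed k]
    [CharZero k] {L : Type v} [LieRing L] [LieAlgebra k L] (hL : LieAlgebra.IsPerfect k L)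
    {M : LieFDRep.{u, v, w} k L} (hM : M.IsIrreducible) (J : LieIdeal k L)
    (hJ : ∀ x ∈ J, ∀ y ∈ J, M.ρ ⁅x, y⁆ = 0) {x : L} (hx : x ∈ J) : M.ρ x = 0 := by
  let q := M.ρ.range
  let f : L →ₗ⁅k⁆ q := M.ρ.rangeRestrict
  have hf : Function.Surjective f := M.ρ.surjective_rangeRestrict
  let M' : LieFDRep.{u, w, w} k q := { V := M.V, ρ := q.incl }
  have hM' : M'.IsIrreducible := (M'.isIrreducible_pullback f hf).1 hM
  have : LieModule.IsIrreducible k q M'.V := hM'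
  have : LieModule.IsFaithful k q M'.V := ⟨fun a b h => Subtype.ext h⟩
  -- Perfectness makes every operator a sum of commutators, so the image is traceless. This excludes
  -- nonzero scalars, which could otherwise form a nontrivial radical.
  have htr : ∀ a, LinearMap.trace k M'.V (LieModule.toEnd k q M'.V a) = 0 := by
    intro a
    obtain ⟨b, rfl⟩ := hf a
    have hb : b ∈ Submodule.span k {m : L | ∃ x y : L, ⁅x, y⁆ = m} := by
      rw [LieAlgebra.isPerfect_iff_span.1 hL]; trivial
    induction hb using Submodule.span_induction with
    | mem b hb =>
      obtain ⟨x, y, rfl⟩ := hb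
      rw [LieHom.map_lie, LieHom.map_lie, LieRing.of_associative_ring_bracket, map_sub,
        LinearMap.trace_mul_comm, sub_self]
    | zero => simp
    | add x y _ _ hx hy => rw [map_add, map_add, map_add, hx, hy, add_zero]
    | smul c x _ hx => rw [map_smul, map_smul, map_smul, hx, smul_zero]
  have hrad := LieAlgebra.hasTrivialRadical_of_isIrreducible_of_isFaithful k q M'.V htr
  rw [LieAlgebra.hasTrivialRadical_iff_no_abelian_ideals] at hrad
  -- By `hJ` the image of `J` is an abelian ideal of an algebra with trivial radical.
  let J' : LieIdeal k q := { J.toSubmodule.map f.toLinearMap with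
    lie_mem := fun {a m} hm => by
      obtain ⟨y, hy, rfl⟩ := hm
      obtain ⟨b, rfl⟩ := hf a
      exact ⟨⁅b, y⁆, J.lie_mem hy, LieHom.map_lie f b y⟩ }
  have hJ' : IsLieAbelian J' := by
    refine ⟨?_⟩
    rintro ⟨_, y, hy, rfl⟩ ⟨_, z, hz, rfl⟩
    refine Subtype.ext (Subtype.ext ?_)
    exact (LieHom.map_lie M.ρ y z).symm.trans (hJ y hy z hz)
  have hmem : f x ∈ J' := ⟨x, hx, rfl⟩
  rw [hrad J' hJ', LieSubmodule.mem_bot] at hmem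
  exact congrArg Subtype.val hmem

end Semiprime

/-! ### Ideals of coefficients, invariant functions and averaging. -/

section Filtration

variable {k : Type u} [Field k] {Γ : Type w₁} [Group Γ] {A : Type v} [CommRing A] [Algebra k A]
  {𝔤 : Type w₂} [LieRing 𝔤] [LieAlgebra k 𝔤]

theorem lie_mem_ideal_smul_top {I I' : Ideal A} {x y : A ⊗[k] 𝔤}
    (hx : x ∈ I • (⊤ : Submodule A (A ⊗[k] 𝔤))) (hy : y ∈ I' • (⊤ : Submodule A (A ⊗[k] 𝔤))) :
    ⁅x, y⁆ ∈ (I * I') • (⊤ : Submodule A (A ⊗[k] 𝔤)) := by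
  induction hx using Submodule.smul_induction_on' with
  | add x _ x' _ hx hx' => rw [add_lie]; exact add_mem hx hx'
  | smul r hr n _ =>
    induction hy using Submodule.smul_induction_on' with
    | add y _ y' _ hy hy' => rw [lie_add]; exact add_mem hy hy'
    | smul r' hr' n' _ =>
      rw [smul_lie, lie_smul, smul_smul]
      exact Submodule.smul_mem_smul (Ideal.mul_mem_mul hr hr') trivial

variable [MulSemiringAction Γ A] [SMulCommClass Γ k A]
  [DistribMulAction Γ 𝔤] [SMulCommClass Γ k 𝔤]

theorem diagAct_smul (γ : Γ) (b : A) (t : A ⊗[k] 𝔤) :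
    diagAct k Γ A 𝔤 γ (b • t) = (γ • b) • diagAct k Γ A 𝔤 γ t := by
  induction t using TensorProduct.induction_on with
  | zero => simp
  | add x y hx hy => simp only [smul_add, map_add, hx, hy]
  | tmul f a => simp [TensorProduct.smul_tmul', smul_mul']

theorem evalLin_smul (x : RatPoint k A) (b : A) (t : A ⊗[k] 𝔤) :
    evalLin x (b • t) = x.eval b • evalLin x t := by
  induction t using TensorProduct.induction_on with
  | zero => simp
  | add x y hx hy => simp only [smul_add, map_add, hx, hy]
  | tmul f a => simp [TensorProduct.smul_tmul', mul_smul]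

variable [IsLieAction Γ 𝔤]

variable (k Γ A 𝔤) in
/-- The equivariant maps with coefficients in an ideal of `A`. -/
noncomputable def equivariantIdeal (I : Ideal A) : LieIdeal k (EquivariantMapAlgebra k Γ A 𝔤) :=
  { ((I • (⊤ : Submodule A (A ⊗[k] 𝔤))).restrictScalars k).comap
      (EquivariantMapAlgebra k Γ A 𝔤).toSubmodule.subtype with
    lie_mem := fun {α β} hβ => by
      have := lie_mem_ideal_smul_top (I := ⊤) (I' := I) (x := α.1) (y := β.1) (by simp) hβ
      rwa [Ideal.top_mul] at this }

theorem mem_equivariantIdeal {I : Ideal A} {α : EquivariantMapAlgebra k Γ A 𝔤} :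
    α ∈ equivariantIdeal k Γ A 𝔤 I ↔ α.1 ∈ I • (⊤ : Submodule A (A ⊗[k] 𝔤)) := Iff.rfl

variable (k Γ A 𝔤) in
/-- The action of the invariant functions on the equivariant maps. -/
noncomputable def invariantSMul : FixedPoints.subalgebra k A Γ →ₐ[k]
    Module.End k (EquivariantMapAlgebra k Γ A 𝔤) where
  toFun b :=
    { toFun := fun α => ⟨b.1 • α.1, fun γ => by rw [diagAct_smul, α.2 γ, b.2 γ]⟩
      map_add' := fun α β => Subtype.ext (smul_add b.1 α.1 β.1)
      map_smul' := fun c α => Subtype.ext (smul_comm b.1 c α.1) }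
  map_one' := LinearMap.ext fun α => Subtype.ext (one_smul A α.1)
  map_mul' b c := LinearMap.ext fun α => Subtype.ext (mul_smul b.1 c.1 α.1)
  map_zero' := LinearMap.ext fun α => Subtype.ext (zero_smul A α.1)
  map_add' b c := LinearMap.ext fun α => Subtype.ext (add_smul b.1 c.1 α.1)
  commutes' c := LinearMap.ext fun α => Subtype.ext (algebraMap_smul A c α.1)

@[simp] theorem coe_invariantSMul (b : FixedPoints.subalgebra k A Γ)
    (α : EquivariantMapAlgebra k Γ A 𝔤) : (invariantSMul k Γ A 𝔤 b α).1 = b.1 • α.1 := rfl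

theorem invariantSMul_lie (b : FixedPoints.subalgebra k A Γ)
    (α β : EquivariantMapAlgebra k Γ A 𝔤) :
    invariantSMul k Γ A 𝔤 b ⁅α, β⁆ = ⁅invariantSMul k Γ A 𝔤 b α, β⁆ :=
  Subtype.ext (smul_lie b.1 α.1 β.1).symm

theorem lie_invariantSMul (b : FixedPoints.subalgebra k A Γ)
    (α β : EquivariantMapAlgebra k Γ A 𝔤) :
    invariantSMul k Γ A 𝔤 b ⁅α, β⁆ = ⁅α, invariantSMul k Γ A 𝔤 b β⁆ :=
  Subtype.ext (lie_smul b.1 α.1 β.1).symm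

variable (k Γ A 𝔤) in
/-- The trace map `A ⊗ 𝔤 → 𝔐`. -/
noncomputable def equivariantTrace [Fintype Γ] : A ⊗[k] 𝔤 →ₗ[k] EquivariantMapAlgebra k Γ A 𝔤 where
  toFun t := ⟨∑ γ : Γ, diagAct k Γ A 𝔤 γ t, sum_diagAct_mem t⟩
  map_add' s t := Subtype.ext (by
    simp only [map_add, Finset.sum_add_distrib]; rfl)
  map_smul' c t := Subtype.ext (by
    simp only [map_smul, ← Finset.smul_sum]; rfl)

theorem coe_equivariantTrace [Fintype Γ] (t : A ⊗[k] 𝔤) :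
    (equivariantTrace k Γ A 𝔤 t).1 = ∑ γ : Γ, diagAct k Γ A 𝔤 γ t := rfl

theorem equivariantTrace_coe [Fintype Γ] (α : EquivariantMapAlgebra k Γ A 𝔤) :
    equivariantTrace k Γ A 𝔤 α.1 = (Fintype.card Γ : k) • α := by
  refine Subtype.ext ?_
  rw [coe_equivariantTrace, Finset.sum_congr rfl fun γ _ => α.2 γ, Finset.sum_const,
    Nat.cast_smul_eq_nsmul]
  rfl

theorem equivariantTrace_smul [Fintype Γ] (b : FixedPoints.subalgebra k A Γ) (t : A ⊗[k] 𝔤) :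
    equivariantTrace k Γ A 𝔤 (b.1 • t) =
      invariantSMul k Γ A 𝔤 b (equivariantTrace k Γ A 𝔤 t) := by
  refine Subtype.ext ?_
  rw [coe_equivariantTrace, coe_invariantSMul, coe_equivariantTrace, Finset.smul_sum]
  exact Finset.sum_congr rfl fun γ _ => by rw [diagAct_smul, b.2 γ]

/-- The trace is linear over invariant functions, so an element of `J` can be moved out of it, where
`hJ` applies. -/
theorem apply_equivariantTrace_eq_zero [Fintype Γ]
    {M : LieFDRep.{u, max v w₂, w} k (EquivariantMapAlgebra k Γ A 𝔤)}
    {J : Ideal (FixedPoints.subalgebra k A Γ)}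
    (hJ : ∀ b ∈ J, ∀ α, M.ρ (invariantSMul k Γ A 𝔤 b α) = 0) {t : A ⊗[k] 𝔤}
    (ht : t ∈ J.map (algebraMap _ A) • (⊤ : Submodule A (A ⊗[k] 𝔤))) :
    M.ρ (equivariantTrace k Γ A 𝔤 t) = 0 := by
  induction ht using Submodule.smul_induction_on' with
  | add x _ y _ hx hy => rw [map_add, map_add, hx, hy, add_zero]
  | smul r hr n _ =>
    induction hr using Submodule.span_induction generalizing n with
    | mem r hr =>
      obtain ⟨b, hb, rfl⟩ := hr
      exact (congrArg M.ρ (equivariantTrace_smul b n)).trans (hJ b hb _)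
    | zero => rw [zero_smul, map_zero, map_zero]
    | add r r' _ _ hr hr' =>
      rw [add_smul, map_add, map_add, hr n trivial, hr' n trivial, add_zero]
    | smul a r _ hr => rw [smul_eq_mul, mul_comm, mul_smul]; exact hr (a • n) trivial

end Filtration

/-! ### Rational points over the ring of invariants. -/

section RationalPoints

variable {k : Type u} [Field k] {Γ : Type w₁} [Group Γ] [Finite Γ]
  {A : Type v} [CommRing A] [Algebra k A] [MulSemiringAction Γ A] [SMulCommClass Γ k A]

theorem isIntegral_fixedPoints (f : A) : IsIntegral (FixedPoints.subalgebra k A Γ) f := by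
  have : Algebra.IsInvariant (FixedPoints.subalgebra k A Γ) A Γ := ⟨fun b hb => ⟨⟨b, hb⟩, rfl⟩⟩
  exact (Algebra.IsInvariant.isIntegral (FixedPoints.subalgebra k A Γ) A Γ).isIntegral f

/-- Primes over an ideal of finite codimension in the ring of invariants are rational points. -/
theorem exists_ratPoint_of_isPrime [IsAlgClosed k] (J : Ideal (FixedPoints.subalgebra k A Γ))
    [Module.Finite k (FixedPoints.subalgebra k A Γ ⧸ J)] (P : Ideal A) [P.IsPrime]
    (hP : ∀ b ∈ J, b.1 ∈ P) : ∃ y : RatPoint k A, ∀ f, y.eval f = 0 ↔ f ∈ P := by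
  let φ : (FixedPoints.subalgebra k A Γ ⧸ J) →ₐ[k] A ⧸ P :=
    Ideal.Quotient.liftₐ J ((Ideal.Quotient.mkₐ k P).comp (Subalgebra.val _)) fun b hb =>
      Ideal.Quotient.eq_zero_iff_mem.2 (hP b hb)
  -- Modulo `P` the invariant functions are integral over `k`, because `A^Γ/J` is
  -- finite-dimensional. As `A` is integral over `A^Γ`, the domain `A/P` is integral over the
  -- algebraically closed field `k`, hence equal to it.
  have h1 : ∀ b : FixedPoints.subalgebra k A Γ, IsIntegral k (Ideal.Quotient.mk P b.1) := fun b =>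
    ((Algebra.IsIntegral.of_finite k _).isIntegral (Ideal.Quotient.mk J b)).map φ
  let ψ : FixedPoints.subalgebra k A Γ →+* integralClosure k (A ⧸ P) :=
    ((Ideal.Quotient.mk P).comp (Subalgebra.val _).toRingHom).codRestrict
      (integralClosure k (A ⧸ P)) h1
  have h2 : Algebra.IsIntegral k (A ⧸ P) := by
    refine ⟨fun x => ?_⟩
    obtain ⟨f, rfl⟩ := Ideal.Quotient.mk_surjective x
    obtain ⟨p, hp, hpf⟩ := isIntegral_fixedPoints (k := k) (Γ := Γ) f
    refine isIntegral_trans (A := integralClosure k (A ⧸ P)) _ ⟨p.map ψ, hp.map ψ, ?_⟩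
    rw [Polynomial.eval₂_map]
    have := congrArg (Ideal.Quotient.mk P) hpf
    rw [Polynomial.hom_eval₂, map_zero] at this
    exact this
  let e := AlgEquiv.ofBijective (Algebra.ofId k (A ⧸ P))
    IsAlgClosed.algebraMap_bijective_of_isIntegral
  refine ⟨(e.symm.toAlgHom.comp (Ideal.Quotient.mkₐ k P) : A →ₐ[k] k), fun f => ?_⟩
  rw [← Ideal.Quotient.eq_zero_iff_mem]
  exact map_eq_zero_iff e.symm e.symm.injective

/-- Invariant functions separate orbits of rational points. -/
theorem RatPoint.mem_orbit_of_eval_eq [CharZero k] {x y : RatPoint k A}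
    (h : ∀ b : FixedPoints.subalgebra k A Γ, x.eval b.1 = y.eval b.1) :
    x ∈ MulAction.orbit Γ y := by
  classical
  have := Fintype.ofFinite Γ
  by_contra hxy
  -- If the orbits were disjoint, the sum of the translates of `f` would be an invariant function
  -- with value 0 at `y` and the order of the stabilizer at `x`.
  let s := (Finset.univ.image (fun γ : Γ => γ • x) ∪ Finset.univ.image fun γ : Γ => γ • y).erase x
  obtain ⟨f, hf1, hf0⟩ := x.exists_eval_eq_one s (Finset.notMem_erase _ _)
  have hF : ∑ γ : Γ, γ • f ∈ FixedPoints.subalgebra k A Γ := fun γ => by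
    rw [Finset.smul_sum]
    exact Fintype.sum_equiv (Equiv.mulLeft γ) _ _ fun δ => smul_smul _ _ _
  have hz : ∀ (z : RatPoint k A) (γ : Γ), z.eval (γ • f) = (γ⁻¹ • z).eval f := fun z γ => by
    rw [RatPoint.eval_smul, inv_inv]
  have h1 := h ⟨_, hF⟩
  have hy : y.eval (∑ γ : Γ, γ • f) = 0 := by
    rw [map_sum]
    refine Finset.sum_eq_zero fun γ _ => ?_
    rw [hz]
    refine hf0 _ (Finset.mem_erase.2 ⟨fun h => hxy ⟨γ⁻¹, h⟩, ?_⟩)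
    exact Finset.mem_union_right _ (Finset.mem_image_of_mem _ (Finset.mem_univ γ⁻¹))
  have hx : x.eval (∑ γ : Γ, γ • f) =
      (Finset.univ.filter fun γ : Γ => γ⁻¹ • x = x).card := by
    rw [map_sum, Finset.card_filter, Nat.cast_sum]
    refine Finset.sum_congr rfl fun γ _ => ?_
    rw [hz]
    split_ifs with hγ
    · rw [hγ, hf1, Nat.cast_one]
    · rw [Nat.cast_zero]
      refine hf0 _ (Finset.mem_erase.2 ⟨hγ, ?_⟩)
      exact Finset.mem_union_left _ (Finset.mem_image_of_mem (fun γ : Γ => γ • x)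
        (Finset.mem_univ γ⁻¹))
  rw [hx, hy, Nat.cast_eq_zero, Finset.card_eq_zero] at h1
  have : (1 : Γ) ∈ (Finset.univ.filter fun γ : Γ => γ⁻¹ • x = x) := by simp
  rw [h1] at this
  exact Finset.notMem_empty _ this

/-- A finite-dimensional algebra has only finitely many characters, and points inducing the same
character of `A^Γ/J` share an orbit. -/
theorem RatPoint.finite_orbits_of_finite_quotient [CharZero k]
    (J : Ideal (FixedPoints.subalgebra k A Γ))
    [Module.Finite k (FixedPoints.subalgebra k A Γ ⧸ J)] :
    ((Quotient.mk _ : RatPoint k A → MulAction.orbitRel.Quotient Γ (RatPoint k A)) ''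
      {y | ∀ b ∈ J, y.eval b.1 = 0}).Finite := by
  let r : {y : RatPoint k A | ∀ b ∈ J, y.eval b.1 = 0} →
      ((FixedPoints.subalgebra k A Γ ⧸ J) →ₐ[k] k) := fun y =>
    Ideal.Quotient.liftₐ J (y.1.eval.comp (Subalgebra.val _)) y.2
  let q : RatPoint k A → MulAction.orbitRel.Quotient Γ (RatPoint k A) := Quotient.mk _
  have hr : ∀ x y, r x = r y → q x = q y := fun x y h => by
    refine Quotient.sound (MulAction.orbitRel_apply.2 (RatPoint.mem_orbit_of_eval_eq fun b => ?_))
    exact congr($h (Ideal.Quotient.mk J b))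
  have hc : ∀ c : q '' {y | ∀ b ∈ J, y.eval b.1 = 0}, ∃ y : {y : RatPoint k A |
      ∀ b ∈ J, y.eval b.1 = 0}, q y = c := fun ⟨c, y, hy, h⟩ => ⟨⟨y, hy⟩, h⟩
  choose g hg using hc
  have : Function.Injective fun c => r (g c) := fun c d h =>
    Subtype.ext ((hg c).symm.trans ((hr _ _ h).trans (hg d)))
  exact @Set.toFinite _ _ (Finite.of_injective _ this)

end RationalPoints

/-! ### The kernel of an irreducible representation. -/

section Kernel

attribute [local instance 100] LieRing.ofAssociativeRing

variable {k : Type u} [Field k] [IsAlgClosed k] [CharZero k] {Γ : Type w₁} [Group Γ]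
  {A : Type v} [CommRing A] [Algebra k A] [MulSemiringAction Γ A] [SMulCommClass Γ k A]
  {𝔤 : Type w₂} [LieRing 𝔤] [LieAlgebra k 𝔤]
  [DistribMulAction Γ 𝔤] [SMulCommClass Γ k 𝔤] [IsLieAction Γ 𝔤]

/-- The invariant functions that map the equivariant map algebra into the kernel of an irreducible
representation form an ideal of finite codimension. -/
theorem exists_annihilator (hp : LieAlgebra.IsPerfect k (EquivariantMapAlgebra k Γ A 𝔤))
    {M : LieFDRep.{u, max v w₂, w} k (EquivariantMapAlgebra k Γ A 𝔤)} (hM : M.IsIrreducible) :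
    ∃ J : Ideal (FixedPoints.subalgebra k A Γ),
      Module.Finite k (FixedPoints.subalgebra k A Γ ⧸ J) ∧
      ∀ b ∈ J, ∀ α, M.ρ (invariantSMul k Γ A 𝔤 b α) = 0 := by
  let K : Submodule k (EquivariantMapAlgebra k Γ A 𝔤) := LinearMap.ker M.ρ.toLinearMap
  have hK : ∀ α, α ∈ K ↔ M.ρ α = 0 := fun α => Iff.rfl
  -- Semiprimeness is applied to the ideal `bK`, whose brackets `[bκ, bκ'] = [κ, b²κ']` lie in `K`.
  have hstable : ∀ b, ∀ α ∈ K, invariantSMul k Γ A 𝔤 b α ∈ K := by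
    intro b α hα
    let I : LieIdeal k (EquivariantMapAlgebra k Γ A 𝔤) :=
      { K.map (invariantSMul k Γ A 𝔤 b) with
        lie_mem := fun {β m} hm => by
          obtain ⟨κ, hκ, rfl⟩ := hm
          refine ⟨⁅β, κ⁆, ?_, lie_invariantSMul b β κ⟩
          change M.ρ ⁅β, κ⁆ = 0
          rw [LieHom.map_lie, (hK κ).1 hκ, lie_zero] }
    refine hM.apply_eq_zero_of_lie_eq_zero hp I ?_ ⟨α, hα, rfl⟩
    rintro _ ⟨κ, hκ, rfl⟩ _ ⟨κ', hκ', rfl⟩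
    rw [← invariantSMul_lie, lie_invariantSMul, LieHom.map_lie, (hK κ).1 hκ, zero_lie]
  -- The ideal sought is the kernel of the action on `𝔐/K`, which is finite-dimensional because it
  -- embeds in `End V`.
  let θ : FixedPoints.subalgebra k A Γ →ₐ[k]
      Module.End k (EquivariantMapAlgebra k Γ A 𝔤 ⧸ K) :=
    AlgHom.ofLinearMap
      { toFun := fun b => K.mapQ K (invariantSMul k Γ A 𝔤 b) (hstable b)
        map_add' := fun b c => by ext; simp
        map_smul' := fun b c => by ext; simp }
      (by ext; simp) (fun b c => by ext; simp)
  have hfin : FiniteDimensional k (EquivariantMapAlgebra k Γ A 𝔤 ⧸ K) :=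
    Module.Finite.equiv (LinearMap.quotKerEquivRange M.ρ.toLinearMap).symm
  refine ⟨RingHom.ker θ, ?_, fun b hb α => ?_⟩
  · exact Module.Finite.of_injective (Ideal.kerLiftAlg θ).toLinearMap (Ideal.kerLiftAlg_injective θ)
  · have := LinearMap.congr_fun (show θ b = 0 from hb) (K.mkQ α)
    exact (Submodule.Quotient.mk_eq_zero K).1 this

variable [Finite Γ] [FiniteDimensional k 𝔤]

/-- An equivariant map that vanishes at all points lying over the annihilator acts as zero. -/
theorem apply_eq_zero_of_evalLin_eq_zero
    (hp : LieAlgebra.IsPerfect k (EquivariantMapAlgebra k Γ A 𝔤))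
    {M : LieFDRep.{u, max v w₂, w} k (EquivariantMapAlgebra k Γ A 𝔤)} (hM : M.IsIrreducible)
    {J : Ideal (FixedPoints.subalgebra k A Γ)}
    [Module.Finite k (FixedPoints.subalgebra k A Γ ⧸ J)]
    (hJ : ∀ b ∈ J, ∀ α, M.ρ (invariantSMul k Γ A 𝔤 b α) = 0)
    (α : EquivariantMapAlgebra k Γ A 𝔤)
    (hα : ∀ y : RatPoint k A, (∀ b ∈ J, y.eval b.1 = 0) → evalLin y α.1 = 0) : M.ρ α = 0 := by
  have := Fintype.ofFinite Γ
  let JA : Ideal A := J.map (algebraMap _ A)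
  let b := Module.finBasis k 𝔤
  let B := Algebra.TensorProduct.basis A b
  have hαB : α.1 = ∑ i, B.repr α.1 i • B i := (B.sum_repr α.1).symm
  -- Every prime over `JA` is the kernel of a rational point at which `α` vanishes, so it contains
  -- all coefficients of `α`.
  have hf : ∀ i, B.repr α.1 i ∈ JA.radical := by
    intro i
    rw [Ideal.radical_eq_sInf, Submodule.mem_sInf]
    rintro P ⟨hJP, hP⟩
    obtain ⟨y, hy⟩ := exists_ratPoint_of_isPrime J P fun b hb =>
      hJP (Ideal.mem_map_of_mem (algebraMap _ A) hb)
    rw [← hy]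
    have h0 := hα y fun b hb => (hy _).2 (hJP (Ideal.mem_map_of_mem (algebraMap _ A) hb))
    rw [hαB, map_sum] at h0
    simp only [evalLin_smul] at h0
    have h1 : ∀ i, evalLin y (B i) = b i := fun i => by
      rw [Algebra.TensorProduct.basis_apply, evalLin_tmul, map_one, one_smul]
    simp only [h1] at h0
    exact Fintype.linearIndependent_iff.1 b.linearIndependent _ h0 i
  let I := Ideal.span (Set.range fun i => B.repr α.1 i)
  have hI : I ≤ JA.radical := Ideal.span_le.2 (by rintro _ ⟨i, rfl⟩; exact hf i)
  have hIfg : I.FG := Submodule.fg_span (Set.finite_range _)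
  obtain ⟨n, hn⟩ := Ideal.exists_pow_le_of_le_radical_of_fg hI hIfg
  -- Here `I^(2^n) ≤ I^n ≤ JA`. The trace of `β` is `|Γ| β`, and it is killed since `β` has
  -- coefficients in `JA`.
  have htop : ∀ β ∈ equivariantIdeal k Γ A 𝔤 (I ^ 2 ^ n), M.ρ β = 0 := by
    intro β hβ
    have h1 : β.1 ∈ JA • (⊤ : Submodule A (A ⊗[k] 𝔤)) :=
      Submodule.smul_mono_left ((Ideal.pow_le_pow_right Nat.lt_two_pow_self.le).trans hn) hβ
    have h2 := apply_equivariantTrace_eq_zero hJ h1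
    rw [equivariantTrace_coe, map_smul] at h2
    exact (smul_eq_zero.1 h2).resolve_left (Nat.cast_ne_zero.2 Fintype.card_ne_zero)
  -- Brackets of maps with coefficients in `I^(2^m)` have coefficients in `I^(2^(m+1))`, so
  -- semiprimeness lowers the exponent.
  have hdesc : ∀ m, (∀ β ∈ equivariantIdeal k Γ A 𝔤 (I ^ 2 ^ m), M.ρ β = 0) →
      ∀ β ∈ equivariantIdeal k Γ A 𝔤 I, M.ρ β = 0 := by
    intro m
    induction m with
    | zero => intro h; simpa using h
    | succ m ih =>
      intro h
      refine ih fun β hβ => hM.apply_eq_zero_of_lie_eq_zero hp _ (fun x hx y hy => h _ ?_) hβ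
      have := lie_mem_ideal_smul_top (mem_equivariantIdeal.1 hx) (mem_equivariantIdeal.1 hy)
      rwa [← pow_add, ← two_mul, ← pow_succ'] at this
  refine hdesc n htop α ?_
  rw [mem_equivariantIdeal, hαB]
  exact Submodule.sum_mem _ fun i _ =>
    Submodule.smul_mem_smul (Ideal.subset_span ⟨i, rfl⟩) trivial

/-- The kernel of an irreducible representation of a perfect equivariant map algebra contains the
maps that vanish on a suitable finite set of points in distinct orbits. -/
theorem exists_finset_apply_eq_zero
    (hp : LieAlgebra.IsPerfect k (EquivariantMapAlgebra k Γ A 𝔤))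
    {M : LieFDRep.{u, max v w₂, w} k (EquivariantMapAlgebra k Γ A 𝔤)} (hM : M.IsIrreducible) :
    ∃ S : Finset (RatPoint k A), (∀ x ∈ S, ∀ y ∈ S, x ∈ MulAction.orbit Γ y → x = y) ∧
      ∀ α, (∀ x ∈ S, evalHom Γ x α = 0) → M.ρ α = 0 := by
  obtain ⟨J, _, hJ⟩ := exists_annihilator hp hM
  obtain ⟨S, -, hS, hcover⟩ := MulAction.exists_finset_orbit_representatives (G := Γ) _
    (RatPoint.finite_orbits_of_finite_quotient J)
  refine ⟨S, hS, fun α hα => apply_eq_zero_of_evalLin_eq_zero hp hM hJ α fun y hy => ?_⟩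
  obtain ⟨x, hx, hxy⟩ := hcover y hy
  obtain ⟨γ, rfl⟩ := MulAction.mem_orbit_symm.1 hxy
  change evalLin (γ • x) α.1 = 0
  rw [← α.2 γ, evalLin_diagAct, ← coe_evalHom_apply, hα x hx]
  exact smul_zero γ

end Kernel

/-! ### Equivariant extension from orbit representatives. -/

section Extension

variable {k : Type u} [Field k] {Γ : Type w₁} [Group Γ]
  {A : Type v} [CommRing A] [Algebra k A] [MulSemiringAction Γ A] [SMulCommClass Γ k A]
  {𝔤 : Type w₂} [LieRing 𝔤] [LieAlgebra k 𝔤] [DistribMulAction Γ 𝔤] [SMulCommClass Γ k 𝔤]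
  [IsLieAction Γ 𝔤]

/-- The map `𝔤^y → 𝔤^x`, `a ↦ γ⁻¹ • a`, for `y = γ • x`. -/
def pointTransport {x y : RatPoint k A} (γ : Γ) (h : γ • x = y) :
    pointSubalgebra Γ 𝔤 y →ₗ⁅k⁆ pointSubalgebra Γ 𝔤 x := h ▸ pointShift γ x

@[simp] theorem coe_pointTransport {x y : RatPoint k A} (γ : Γ) (h : γ • x = y)
    (a : pointSubalgebra Γ 𝔤 y) : (pointTransport γ h a : 𝔤) = γ⁻¹ • a.1 := by
  subst h; rfl

theorem pointTransport_surjective {x y : RatPoint k A} (γ : Γ) (h : γ • x = y) :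
    Function.Surjective (pointTransport (𝔤 := 𝔤) γ h) := fun a =>
  ⟨pointTransport γ⁻¹ (inv_smul_eq_iff.2 h.symm) a, Subtype.ext (by simp)⟩

/-- Two group elements carrying `x` to `y` differ by an element of the stabilizer of `y`, which
fixes `𝔤^y`. -/
theorem pointTransport_eq {x y : RatPoint k A} (γ δ : Γ) (h : γ • x = y) (h' : δ • x = y) :
    pointTransport (𝔤 := 𝔤) γ h = pointTransport δ h' := by
  refine LieHom.ext fun a => Subtype.ext ?_
  rw [coe_pointTransport, coe_pointTransport, inv_smul_eq_iff, smul_smul]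
  refine (a.2 _ ?_).symm
  rw [MulAction.mem_stabilizer_iff, mul_smul, inv_smul_eq_iff.2 h'.symm, h]

theorem pointTransport_comp {x y z : RatPoint k A} (γ δ : Γ) (h : γ • x = y) (h' : δ • y = z) :
    (pointTransport (𝔤 := 𝔤) γ h).comp (pointTransport δ h') =
      pointTransport (δ * γ) (by rw [mul_smul, h, h']) := by
  refine LieHom.ext fun a => Subtype.ext ?_
  rw [LieHom.comp_apply]
  simp [mul_smul]

open Classical in
/-- The equivariant extension of a family of classes on points in distinct orbits, trivial
elsewhere. -/
noncomputable def equivariantExtension (S : Finset (RatPoint k A))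
    (c : ∀ x : S, RepClass.{u, w₂, max u v} k (pointSubalgebra Γ 𝔤 x.1)) (y : RatPoint k A) :
    RepClass.{u, w₂, max u v} k (pointSubalgebra Γ 𝔤 y) :=
  if h : ∃ (x : S) (γ : Γ), γ • x.1 = y then
    (c h.choose).pullback (pointTransport h.choose_spec.choose h.choose_spec.choose_spec)
  else RepClass.trivial.{u, w₂, v} k _

variable {S : Finset (RatPoint k A)}
  (c : ∀ x : S, RepClass.{u, w₂, max u v} k (pointSubalgebra Γ 𝔤 x.1))

/-- Neither choice in the definition matters: `hS` makes the representative unique, and the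
transport depends only on its end points. -/
theorem equivariantExtension_eq (hS : ∀ x ∈ S, ∀ y ∈ S, x ∈ MulAction.orbit Γ y → x = y)
    (x : S) (γ : Γ) {y : RatPoint k A} (h : γ • x.1 = y) :
    equivariantExtension S c y = (c x).pullback (pointTransport γ h) := by
  have hex : ∃ (x : S) (γ : Γ), γ • x.1 = y := ⟨x, γ, h⟩
  have key : ∀ (x' : S) (γ' : Γ) (h' : γ' • x'.1 = y),
      (c x').pullback (pointTransport γ' h') = (c x).pullback (pointTransport γ h) := by
    intro x' γ' h'
    obtain rfl : x' = x := Subtype.ext (hS _ x'.2 _ x.2 ⟨γ'⁻¹ * γ, by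
      change (γ'⁻¹ * γ) • x.1 = x'.1
      rw [mul_smul, h, inv_smul_eq_iff, h']⟩)
    rw [pointTransport_eq γ' γ h' h]
  rw [equivariantExtension, dif_pos hex]
  exact key _ _ _

theorem equivariantExtension_of_not {y : RatPoint k A} (h : ¬∃ (x : S) (γ : Γ), γ • x.1 = y) :
    equivariantExtension S c y = RepClass.trivial.{u, w₂, v} k _ := dif_neg h

theorem equivariantExtension_coe (hS : ∀ x ∈ S, ∀ y ∈ S, x ∈ MulAction.orbit Γ y → x = y)
    (x : S) : equivariantExtension S c x.1 = c x := by
  rw [equivariantExtension_eq c hS x 1 (one_smul Γ _)]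
  have : pointTransport (𝔤 := 𝔤) (1 : Γ) (one_smul Γ x.1) = LieHom.id :=
    LieHom.ext fun a => Subtype.ext (by simp)
  rw [this]
  induction c x using Quotient.inductionOn with
  | h M => rfl

/-- The parameter with prescribed classes at points in distinct orbits, trivial elsewhere. -/
noncomputable def EvalParam.ofFinset [Finite Γ]
    (hS : ∀ x ∈ S, ∀ y ∈ S, x ∈ MulAction.orbit Γ y → x = y)
    (hc : ∀ x, (c x).IsIrreducible) : EvalParam k Γ A 𝔤 where
  toFun := equivariantExtension S c
  irreducible y := by
    by_cases h : ∃ (x : S) (γ : Γ), γ • x.1 = y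
    · obtain ⟨x, γ, h⟩ := h
      rw [equivariantExtension_eq c hS x γ h,
        RepClass.isIrreducible_pullback _ _ (pointTransport_surjective γ h)]
      exact hc x
    · rw [equivariantExtension_of_not c h]
      exact RepClass.isIrreducible_trivial
  equivariant δ y := by
    by_cases h : ∃ (x : S) (γ : Γ), γ • x.1 = y
    · obtain ⟨x, γ, h⟩ := h
      rw [equivariantExtension_eq c hS x γ h,
        equivariantExtension_eq c hS x (δ * γ) (y := δ • y) (by rw [mul_smul, h]),
        RepClass.pullback_pullback]
      exact congrArg (c x).pullback (pointTransport_comp γ δ h rfl)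
    · rw [equivariantExtension_of_not c h, equivariantExtension_of_not c]
      · exact RepClass.pullback_trivial _
      · rintro ⟨x, γ, h'⟩
        exact h ⟨x, δ⁻¹ * γ, by rw [mul_smul, h', inv_smul_smul]⟩
  finite_support := by
    refine ((Set.finite_range fun p : Γ × S => p.1 • p.2.1)).subset fun y hy => ?_
    by_contra h
    refine hy (equivariantExtension_of_not c ?_)
    rintro ⟨x, γ, h'⟩
    exact h ⟨(γ, x), h'⟩

end Extension

/-! ### Surjectivity and the bijection. -/

section Surjectivity

variable {k : Type u} [Field k] [IsAlgClosed k] [CharZero k] {Γ : Type w₁} [Group Γ] [Finite Γ]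
  {A : Type v} [CommRing A] [Algebra k A] [MulSemiringAction Γ A] [SMulCommClass Γ k A]
  {𝔤 : Type w₂} [LieRing 𝔤] [LieAlgebra k 𝔤] [FiniteDimensional k 𝔤]
  [DistribMulAction Γ 𝔤] [SMulCommClass Γ k 𝔤] [IsLieAction Γ 𝔤]

/-- The representation factors through evaluation at a finite set `S`, and its tensor factors extend
equivariantly to `Ψ`. Some factors may be trivial, so `S` may exceed the support. -/
theorem EvalParam.exists_evalClass_eq
    (hp : LieAlgebra.IsPerfect k (EquivariantMapAlgebra k Γ A 𝔤))
    {c : RepClass.{u, max v w₂, max u v} k (EquivariantMapAlgebra k Γ A 𝔤)}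
    (hc : c.IsIrreducible) : ∃ Ψ : EvalParam k Γ A 𝔤, Ψ.evalClass = c := by
  classical
  obtain ⟨M, rfl, hM⟩ := hc
  obtain ⟨S, hS, hker⟩ := exists_finset_apply_eq_zero hp hM
  obtain ⟨W, hW, hMW⟩ := LieFDRep.exists_mk_eq_tensor
    (fun x : S => evalHom (𝔤 := 𝔤) Γ x.1)
    (fun x a => by
      obtain ⟨α, h1, h2⟩ := exists_evalHom_eq hS x.2 a
      exact ⟨α, h1, fun y hy => h2 y y.2 fun h => hy (Subtype.ext h)⟩)
    M hM (fun α hα => hker α fun x hx => hα ⟨x, hx⟩)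
  let Ψ := EvalParam.ofFinset (fun x : S => RepClass.mk (W x)) hS
    fun x => (RepClass.isIrreducible_mk_iff _).2 (hW x)
  refine ⟨Ψ, ?_⟩
  rw [Ψ.evalClass_eq_of_cover hS (fun y hy => ?_) W fun x =>
    (equivariantExtension_coe (Γ := Γ) (fun x : S => RepClass.mk (W x)) hS x).symm, hMW]
  · unfold evalRep
    congr!
  · by_contra h
    refine hy (equivariantExtension_of_not (Γ := Γ) (fun x : S => RepClass.mk (W x)) (y := y) ?_)
    rintro ⟨x, γ, rfl⟩
    exact h ⟨x.1, x.2, γ⁻¹, inv_smul_smul γ x.1⟩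

theorem EvalParam.bijOn_evalClass
    (hp : LieAlgebra.IsPerfect k (EquivariantMapAlgebra k Γ A 𝔤)) :
    Set.BijOn (fun Ψ : EvalParam k Γ A 𝔤 => Ψ.evalClass) Set.univ {c | c.IsIrreducible} :=
  ⟨fun Ψ _ => Ψ.isIrreducible_evalClass, EvalParam.evalClass_injective.injOn, fun _ hc =>
    let ⟨Ψ, h⟩ := EvalParam.exists_evalClass_eq hp hc
    ⟨Ψ, trivial, h⟩⟩

end Surjectivity

/-! ### Gradings by the principal element. -/

section EigenvectorSpan

variable {k : Type u} [Field k] [CharZero k] {L : Type v} [LieRing L] [LieAlgebra k L]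

/-- Bracketing with `u` is a derivation, so an iterated bracket of `m` generators is an eigenvector
with eigenvalue `m c`; this is nonzero in characteristic 0 and can be divided out. -/
theorem LieAlgebra.exists_lie_eq_of_mem_lieSpan {u : L} {c : k} (hc : c ≠ 0) {s : Set L}
    (hs : ∀ x ∈ s, ⁅u, x⁆ = c • x) {x : L} (hx : x ∈ LieSubalgebra.lieSpan k L s) :
    ∃ y, ⁅u, y⁆ = x := by
  have key : x ∈ Submodule.span k {x : L | ∃ m : ℕ, m ≠ 0 ∧ ⁅u, x⁆ = (m * c : k) • x} := by
    induction hx using LieSubalgebra.lieSpan_induction with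
    | mem x hx => exact Submodule.subset_span ⟨1, one_ne_zero, by simp [hs x hx]⟩
    | zero => exact zero_mem _
    | add x y _ _ hx hy => exact add_mem hx hy
    | smul t x _ hx => exact Submodule.smul_mem _ t hx
    | lie x y hx' hy' hx hy =>
      clear hx' hy'
      induction hx using Submodule.span_induction with
      | mem x hx =>
        obtain ⟨m, hm, hx⟩ := hx
        induction hy using Submodule.span_induction with
        | mem y hy =>
          obtain ⟨n, -, hy⟩ := hy
          refine Submodule.subset_span ⟨m + n, by omega, ?_⟩
          rw [leibniz_lie, hx, hy, smul_lie, lie_smul, ← add_smul, Nat.cast_add, add_mul]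
        | zero => rw [lie_zero]; exact zero_mem _
        | add y z _ _ hy hz => rw [lie_add]; exact add_mem hy hz
        | smul t y _ hy => rw [lie_smul]; exact Submodule.smul_mem _ t hy
      | zero => rw [zero_lie]; exact zero_mem _
      | add y z _ _ hy hz => rw [add_lie]; exact add_mem hy hz
      | smul t y _ hy => rw [smul_lie]; exact Submodule.smul_mem _ t hy
  clear hx
  induction key using Submodule.span_induction with
  | mem x hx =>
    obtain ⟨m, hm, hx⟩ := hx
    refine ⟨(m * c : k)⁻¹ • x, ?_⟩
    rw [lie_smul, hx, inv_smul_smul₀ (mul_ne_zero (Nat.cast_ne_zero.2 hm) hc)]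
  | zero => exact ⟨0, lie_zero u⟩
  | add x y _ _ hx hy =>
    obtain ⟨x', rfl⟩ := hx
    obtain ⟨y', rfl⟩ := hy
    exact ⟨x' + y', lie_add _ _ _⟩
  | smul t x _ hx =>
    obtain ⟨x', rfl⟩ := hx
    exact ⟨t • x', lie_smul _ _ _⟩

/-- The Cartan matrix is nonsingular, so some combination of the `h j` takes the value 1 on all
simple roots. -/
theorem LieAlgebra.Basis.exists_lie_e_eq {ι : Type*} [Finite ι] {H : LieSubalgebra k L}
    (b : LieAlgebra.Basis ι H) :
    ∃ ρ : L, (∀ i, ⁅ρ, b.e i⁆ = b.e i) ∧ ∀ i, ⁅ρ, b.f i⁆ = -b.f i := by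
  classical
  have := Fintype.ofFinite ι
  let B : Matrix ι ι k := b.A.map (Int.castRingHom k)
  have hB : IsUnit B.det := by
    rw [isUnit_iff_ne_zero, show B = (Int.castRingHom k).mapMatrix b.A from rfl, ← RingHom.map_det]
    simpa using b.nondegen.det_ne_zero
  obtain ⟨c, hc⟩ : ∃ c, B.mulVec c = 1 :=
    ⟨B⁻¹.mulVec 1, by rw [Matrix.mulVec_mulVec, Matrix.mul_nonsing_inv _ hB, Matrix.one_mulVec]⟩
  have hc' : ∀ i, ∑ j, c j * (b.A i j : k) = 1 := fun i =>
    (Finset.sum_congr rfl fun j _ => mul_comm _ _).trans (congrFun hc i)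
  refine ⟨∑ j, c j • b.h j, fun i => ?_, fun i => ?_⟩
  · simp_rw [sum_lie, smul_lie, b.lie_h_e, ← Int.cast_smul_eq_zsmul k, smul_smul,
      ← Finset.sum_smul, hc', one_smul]
  · simp_rw [sum_lie, smul_lie, b.lie_h_f, ← Int.cast_smul_eq_zsmul k, smul_smul,
      ← Finset.sum_smul, Int.cast_neg, mul_neg, Finset.sum_neg_distrib, hc', neg_smul, one_smul]

end EigenvectorSpan

/-! ### Criteria for perfectness. -/

section Criteria

variable {k : Type u} [Field k] {Γ : Type w₁} [Group Γ]
  {𝔤 : Type w₂} [LieRing 𝔤] [LieAlgebra k 𝔤]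
  [DistribMulAction Γ 𝔤] [SMulCommClass Γ k 𝔤] [IsLieAction Γ 𝔤]

theorem sum_smul_mem_invariants [Fintype Γ] (a : 𝔤) : ∑ γ : Γ, γ • a ∈ invariants k Γ 𝔤 := by
  intro γ _
  rw [Finset.smul_sum]
  exact Fintype.sum_equiv (Equiv.mulLeft γ) _ _ fun δ => smul_smul _ _ _

variable (k Γ 𝔤) in
/-- An element of `Γ` as an automorphism of `𝔤`. -/
def lieActionEquiv (γ : Γ) : 𝔤 ≃ₗ⁅k⁆ 𝔤 :=
  { DistribMulAction.toLinearEquiv k 𝔤 γ with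
    map_lie' := fun {a b} => IsLieAction.smul_lie_smul γ a b }

theorem killingForm_smul_smul (γ : Γ) (a b : 𝔤) :
    killingForm k 𝔤 (γ • a) (γ • b) = killingForm k 𝔤 a b :=
  LieAlgebra.killingForm_of_equiv_apply (lieActionEquiv k Γ 𝔤 γ) a b

variable [CharZero k] [Finite Γ]

/-- For invariant `a`, the trace of `f ⊗ [a, c]` is the bracket of `1 ⊗ a` with the trace of `f ⊗
c`. On `𝔐` the trace is multiplication by `|Γ|`, so traces exhaust `𝔐`. -/
theorem InvariantsGenerate.isPerfect (h : InvariantsGenerate k Γ 𝔤)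
    (A : Type v) [CommRing A] [Algebra k A] [MulSemiringAction Γ A] [SMulCommClass Γ k A] :
    LieAlgebra.IsPerfect k (EquivariantMapAlgebra k Γ A 𝔤) := by
  have := Fintype.ofFinite Γ
  rw [LieAlgebra.isPerfect_iff_span, eq_top_iff]
  have htr : ∀ t : A ⊗[k] 𝔤, equivariantTrace k Γ A 𝔤 t ∈
      Submodule.span k {m : EquivariantMapAlgebra k Γ A 𝔤 |
        ∃ x y : EquivariantMapAlgebra k Γ A 𝔤, ⁅x, y⁆ = m} := by
    intro t
    induction t using TensorProduct.induction_on with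
    | zero => rw [map_zero]; exact zero_mem _
    | add x y hx hy => rw [map_add]; exact add_mem hx hy
    | tmul f a =>
      have ha : a ∈ Submodule.span k {b : 𝔤 | ∃ a ∈ invariants k Γ 𝔤, ∃ c : 𝔤, b = ⁅a, c⁆} := by
        rw [show Submodule.span k _ = ⊤ from h]; trivial
      induction ha using Submodule.span_induction with
      | mem a ha =>
        obtain ⟨a, ha, c, rfl⟩ := ha
        have ha' : (1 : A) ⊗ₜ[k] a ∈ EquivariantMapAlgebra k Γ A 𝔤 := fun γ => by
          rw [diagAct_tmul, smul_one, ha γ trivial]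
        refine Submodule.subset_span ⟨⟨_, ha'⟩, equivariantTrace k Γ A 𝔤 (f ⊗ₜ c), Subtype.ext ?_⟩
        rw [LieSubalgebra.coe_bracket, coe_equivariantTrace, coe_equivariantTrace, lie_sum]
        refine Finset.sum_congr rfl fun γ _ => ?_
        rw [diagAct_tmul, diagAct_tmul, LieAlgebra.ExtendScalars.bracket_tmul, one_mul,
          IsLieAction.smul_lie_smul, ha γ trivial]
      | zero => rw [TensorProduct.tmul_zero, map_zero]; exact zero_mem _
      | add x y _ _ hx hy => rw [TensorProduct.tmul_add, map_add]; exact add_mem hx hy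
      | smul c x _ hx => rw [TensorProduct.tmul_smul, map_smul]; exact Submodule.smul_mem _ c hx
  intro α _
  have := htr α.1
  rw [equivariantTrace_coe] at this
  exact (Submodule.smul_mem_iff _ (Nat.cast_ne_zero.2 Fintype.card_ne_zero)).1 this

/-- The sum of the translates of `ρ` is invariant and acts on the `e i` and `f i` by `|Γ|` and
`-|Γ|`, which covers both nilpotent parts. The Cartan part is covered by `h i = [∑ e j, f i]`, where
`∑ e j` is invariant. -/
theorem ActsByDiagramAutomorphisms.invariantsGenerate (h : ActsByDiagramAutomorphisms k Γ 𝔤) :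
    InvariantsGenerate k Γ 𝔤 := by
  obtain ⟨-, n, H, b, π, hπ⟩ := h
  have := Fintype.ofFinite Γ
  have hcard : (Fintype.card Γ : k) ≠ 0 := Nat.cast_ne_zero.2 Fintype.card_ne_zero
  have hmem : ∀ u ∈ invariants k Γ 𝔤, ∀ c : 𝔤, ⁅u, c⁆ ∈
      Submodule.span k {b : 𝔤 | ∃ a ∈ invariants k Γ 𝔤, ∃ c : 𝔤, b = ⁅a, c⁆} :=
    fun u hu c => Submodule.subset_span ⟨u, hu, c, rfl⟩
  obtain ⟨ρ, hρe, hρf⟩ := b.exists_lie_e_eq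
  have hperm : ∀ (γ : Γ) (i : Fin n), π γ (π γ⁻¹ i) = i := fun γ i => by
    rw [map_inv]; exact Equiv.apply_symm_apply _ _
  -- Each translate of `ρ` fixes every `e i` under the bracket, since `γ` only permutes these
  -- generators.
  have he : ∀ x ∈ Set.range b.e,
      ⁅∑ γ : Γ, γ • ρ, x⁆ = (Fintype.card Γ : k) • x := by
    rintro _ ⟨i, rfl⟩
    rw [sum_lie, Finset.sum_congr rfl (g := fun _ => b.e i) fun γ _ => ?_, Finset.sum_const,
      Nat.cast_smul_eq_nsmul]
    · rfl
    · conv_lhs => rw [← hperm γ i, ← ((hπ γ).2 _).1, ← IsLieAction.smul_lie_smul, hρe,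
        ((hπ γ).2 _).1, hperm]
  have hf : ∀ x ∈ Set.range b.f,
      ⁅∑ γ : Γ, γ • ρ, x⁆ = (-(Fintype.card Γ : k)) • x := by
    rintro _ ⟨i, rfl⟩
    rw [sum_lie, Finset.sum_congr rfl (g := fun _ => -b.f i) fun γ _ => ?_, Finset.sum_const,
      neg_smul, Nat.cast_smul_eq_nsmul, smul_neg]
    · rfl
    · conv_lhs => rw [← hperm γ i, ← ((hπ γ).2 _).2.1, ← IsLieAction.smul_lie_smul, hρf,
        smul_neg, ((hπ γ).2 _).2.1, hperm]
  have hh : ∀ i, ⁅∑ j, b.e j, b.f i⁆ = b.h i := fun i => by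
    rw [sum_lie, Finset.sum_eq_single i (fun j _ hj => b.lie_e_f_ne j i hj)
      (fun h => absurd (Finset.mem_univ i) h), (b.sl2 i).lie_e_f]
  have hesum : ∑ j, b.e j ∈ invariants k Γ 𝔤 := fun γ _ => by
    rw [Finset.smul_sum]
    exact Fintype.sum_equiv (π γ) _ _ fun j => ((hπ γ).2 j).1
  have htop : H.toLieSubmodule ⊔ b.borelLower ⊔ b.borelUpper = ⊤ := by
    simpa using b.iSup_cartan_borelLower_borelUpper_eq_top
  refine eq_top_iff.2 fun x _ => ?_
  have hx : x ∈ H.toLieSubmodule ⊔ b.borelLower ⊔ b.borelUpper := by rw [htop]; trivial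
  obtain ⟨v, hv, z, hz, rfl⟩ := (LieSubmodule.mem_sup _ _ _).1 hx
  obtain ⟨y, hy, w, hw, rfl⟩ := (LieSubmodule.mem_sup _ _ _).1 hv
  refine add_mem (add_mem ?_ ?_) ?_
  · have hy : y ∈ H.toSubmodule := hy
    rw [b.coe_cartan_eq_span] at hy
    refine Submodule.span_le.2 ?_ hy
    rintro _ ⟨i, rfl⟩
    rw [← hh]
    exact hmem _ hesum _
  · obtain ⟨v, rfl⟩ := LieAlgebra.exists_lie_eq_of_mem_lieSpan (neg_ne_zero.2 hcard) hf hw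
    exact hmem _ (sum_smul_mem_invariants ρ) v
  · obtain ⟨v, rfl⟩ := LieAlgebra.exists_lie_eq_of_mem_lieSpan hcard he hz
    exact hmem _ (sum_smul_mem_invariants ρ) v

variable [FiniteDimensional k 𝔤]

/-- The Killing form identifies functionals vanishing on `[𝔤^Γ, 𝔤]` with elements of the centralizer
`Z` of `𝔤^Γ`, so it suffices that `Z = 0`. As `Z` is `Γ`-stable and meets `𝔤_Γ` in 0, each `γ • y -
y` with `y ∈ Z` vanishes. Thus `y` is invariant, and it is shown to be orthogonal to all of `𝔤`. -/
theorem SimplePerfectInvariants.invariantsGenerate (h : SimplePerfectInvariants k Γ 𝔤) :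
    InvariantsGenerate k Γ 𝔤 := by
  obtain ⟨hsimple, -, hperf, hmoved⟩ := h
  have := Fintype.ofFinite Γ
  have hcard : (Fintype.card Γ : k) ≠ 0 := Nat.cast_ne_zero.2 Fintype.card_ne_zero
  have hnd := LieAlgebra.IsKilling.killingForm_nondegenerate k 𝔤
  let Z : Submodule k 𝔤 :=
    { carrier := {y | ∀ u ∈ invariants k Γ 𝔤, ⁅u, y⁆ = 0}
      add_mem' := fun ha hb u hu => by rw [lie_add, ha u hu, hb u hu, add_zero]
      zero_mem' := fun u _ => lie_zero u
      smul_mem' := fun c y hy u hu => by rw [lie_smul, hy u hu, smul_zero] }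
  have hZsmul : ∀ (γ : Γ), ∀ y ∈ Z, γ • y ∈ Z := by
    intro γ y hy u hu
    have : ⁅u, γ • y⁆ = γ • ⁅u, y⁆ := by
      rw [IsLieAction.smul_lie_smul, hu γ trivial]
    rw [this, hy u hu, smul_zero]
  have hZmoved : Z ⊓ movedSubspace k Γ 𝔤 = ⊥ := by
    let N : LieSubmodule k (invariants k Γ 𝔤) 𝔤 := { Z ⊓ movedSubspace k Γ 𝔤 with
      lie_mem := fun {u y} hy => by
        have : ⁅u, y⁆ = 0 := hy.1 u.1 u.2
        rw [this]
        exact (Z ⊓ movedSubspace k Γ 𝔤).zero_mem }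
    have hN : N = ⊥ := hmoved N inf_le_right ⟨fun u y => Subtype.ext (y.2.1 u.1 u.2)⟩
    exact congr(($hN).toSubmodule)
  have hZ : Z = ⊥ := by
    rw [eq_bot_iff]
    intro y hy
    have hyinv : ∀ γ : Γ, γ • y = y := by
      intro γ
      have : γ • y - y ∈ Z ⊓ movedSubspace k Γ 𝔤 :=
        ⟨sub_mem (hZsmul γ y hy) hy, Submodule.subset_span ⟨γ, y, rfl⟩⟩
      rw [hZmoved, Submodule.mem_bot] at this
      exact sub_eq_zero.1 this
    refine hnd.1 y fun c => ?_
    -- Invariance of `y` reduces orthogonality to `𝔤` to orthogonality to `𝔤^Γ`. The latter holds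
    -- because `𝔤^Γ` is spanned by brackets `[v, w]`, whose pairing with `y` is that of `[y, v] = 0`
    -- with `w`.
    have h1 : killingForm k 𝔤 y (∑ γ : Γ, γ • c) = (Fintype.card Γ : k) * killingForm k 𝔤 y c := by
      rw [map_sum, Finset.sum_congr rfl (g := fun _ => killingForm k 𝔤 y c) fun γ _ => ?_,
        Finset.sum_const, nsmul_eq_mul]
      · rfl
      · rw [← killingForm_smul_smul (Γ := Γ) γ y c, hyinv]
    have h2 : ∀ u : invariants k Γ 𝔤, killingForm k 𝔤 y u.1 = 0 := by
      intro u
      have hu : u ∈ Submodule.span k {m : invariants k Γ 𝔤 |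
          ∃ x y : invariants k Γ 𝔤, ⁅x, y⁆ = m} := by
        rw [LieAlgebra.isPerfect_iff_span.1 hperf]; trivial
      induction hu using Submodule.span_induction with
      | mem u hu =>
        obtain ⟨v, w, rfl⟩ := hu
        have h3 : ⁅y, v.1⁆ = 0 := by rw [← lie_skew, hy v.1 v.2, neg_zero]
        rw [LieSubalgebra.coe_bracket, ← LieModule.traceForm_apply_lie_apply, h3, map_zero]
        rfl
      | zero => exact map_zero _
      | add x z _ _ hx hz => exact (map_add _ _ _).trans (by rw [hx, hz, add_zero])
      | smul c x _ hx => exact (map_smul _ _ _).trans (by rw [hx, smul_zero])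
    rw [h2 ⟨_, sum_smul_mem_invariants c⟩] at h1
    exact (mul_eq_zero.1 h1.symm).resolve_left hcard
  by_contra hne
  obtain ⟨f, hf0, hf⟩ := Submodule.exists_le_ker_of_lt_top _ (lt_top_iff_ne_top.2 hne)
  obtain ⟨y, rfl⟩ := (LinearMap.BilinForm.toDual (killingForm k 𝔤) hnd).surjective f
  have hy : y ∈ Z := by
    intro u hu
    refine hnd.1 _ fun c => ?_
    rw [← lie_skew, map_neg, LinearMap.neg_apply, LieModule.traceForm_apply_lie_apply, neg_eq_zero]
    exact hf (Submodule.subset_span ⟨u, hu, c, rfl⟩)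
  rw [hZ, Submodule.mem_bot] at hy
  exact hf0 (by rw [hy, map_zero])

end Criteria

theorem mainTheorem3 {k : Type u} [Field k] [IsAlgClosed k] [CharZero k]
    {Γ : Type w₁} [Group Γ] [Finite Γ]
    {A : Type v} [CommRing A] [Algebra k A] [MulSemiringAction Γ A] [SMulCommClass Γ k A]
    {𝔤 : Type w₂} [LieRing 𝔤] [LieAlgebra k 𝔤] [FiniteDimensional k 𝔤]
    [DistribMulAction Γ 𝔤] [SMulCommClass Γ k 𝔤] [IsLieAction Γ 𝔤] :
    (LieAlgebra.IsPerfect k (EquivariantMapAlgebra k Γ A 𝔤) →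
      Set.BijOn (fun Ψ : EvalParam k Γ A 𝔤 => Ψ.evalClass) Set.univ
        {c | c.IsIrreducible}) ∧
    (InvariantsGenerate k Γ 𝔤 ∨ SimplePerfectInvariants k Γ 𝔤 ∨
        ActsByDiagramAutomorphisms k Γ 𝔤 →
      LieAlgebra.IsPerfect k (EquivariantMapAlgebra k Γ A 𝔤) ∧
      Set.BijOn (fun Ψ : EvalParam k Γ A 𝔤 => Ψ.evalClass) Set.univ
        {c | c.IsIrreducible}) :=
  ⟨EvalParam.bijOn_evalClass, fun h =>
    have hp := InvariantsGenerate.isPerfect (h.elim id fun h =>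
      h.elim SimplePerfectInvariants.invariantsGenerate
        ActsByDiagramAutomorphisms.invariantsGenerate) A
    ⟨hp, EvalParam.bijOn_evalClass hp⟩⟩
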